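/- **Definitions.** Let $\mathcal H$ be the upper half-plane and $q=e^{2\pi i z}$. A quasimodular form of weight $w$, depth $s$ and level $1$ is a holomorphic function $F:\mathcal H\to\mathbb C$ for which there are holomorphic functions $F_0,\dots,F_s:\mathcal H\to\mathbb C$, each bounded as $\operatorname{Im} z\to\infty$, such that $$(cz+d)^{-w}F\!\left(\frac{az+b}{cz+d}\right)=\sum_{r=0}^{s}F_r(z)\left(\frac{c}{cz+d}\right)^r\qquad\text{for all }\begin{pmatrix}a&b\\c&d\end{pmatrix}\in \mathrm{SL}_2(\mathbb Z),\ z\in\mathcal H$$ (so depth $s$ includes smaller depths). Such an $F$ has an expansion $F=\sum_{n\ge 0}a_nq^n$; if $F\neq 0$, its vanishing order at infinity is the least $n$ with $a_n\ne 0$. A nonzero quasimodular form of weight $w$ and depth $s$ is *extremal* if its vanishing order at infinity is the highest among all nonzero quasimodular forms of weight $w$ and depth $s$, and *normalized* if its first nonzero coefficient $a_n$ is $1$. **Theorem.** Let $w\ge 6$ be an even integer. There is exactly one normalized extremal quasimodular form $X_{w,1}$ of weight $w$, depth $1$ and level $1$; it takes real values on the positive imaginary axis, and the function $$t\longmapsto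 t^{\,w-\lceil w/6\rceil}\,X_{w,1}(it)$$ is monotone decreasing (that is, non-increasing) on $(0,\infty)$. -/

import Mathlib

open UpperHalfPlane
open scoped MatrixGroups ModularForm Manifold

/-- `F` is a quasimodular form of weight `w`, depth `s` and level `SL(2, ℤ)`: it is holomorphic on
the upper half-plane and there are holomorphic functions `f 0, …, f s`, bounded at `i∞`, with
`(F ∣[w] γ) z = ∑ r ≤ s, f r z * (c / (c z + d)) ^ r` for all `γ = (a b; c d)` in `SL(2, ℤ)`.
In particular `F = f 0`; functions of depth smaller than `s` are included. -/
def IsQuasimodularForm (w : ℤ) (s : ℕ) (F : ℍ → ℂ) : Prop :=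
  MDiff F ∧ ∃ f : Fin (s + 1) → ℍ → ℂ,
    (∀ r, MDiff (f r)) ∧ (∀ r, IsBoundedAtImInfty (f r)) ∧
    ∀ (γ : SL(2, ℤ)) (z : ℍ),
      (F ∣[w] γ) z = ∑ r, f r z * (((γ 1 0 : ℤ) : ℂ) / denom γ z) ^ (r : ℕ)

/-- The vanishing order at `i∞`: the order in `q = exp (2 π i z)` of the `q`-expansion of `F`. -/
noncomputable def orderAtInfty (F : ℍ → ℂ) : ℕ∞ :=
  (qExpansion 1 F).order

/-- `F` is an extremal quasimodular form of weight `w` and depth `s` (of level one): it is nonzero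
and has the highest vanishing order at `i∞` among all nonzero quasimodular forms of weight `w` and
depth `s`. -/
def IsExtremalQuasimodularForm (w : ℤ) (s : ℕ) (F : ℍ → ℂ) : Prop :=
  IsQuasimodularForm w s F ∧ F ≠ 0 ∧
    ∀ G : ℍ → ℂ, IsQuasimodularForm w s G → G ≠ 0 → orderAtInfty G ≤ orderAtInfty F

/-- An extremal quasimodular form is normalized when the first nonzero coefficient of its
`q`-expansion is `1`. -/
def IsNormalizedExtremal (w : ℤ) (s : ℕ) (F : ℍ → ℂ) : Prop :=
  IsExtremalQuasimodularForm w s F ∧ (qExpansion 1 F).coeff (orderAtInfty F).toNat = 1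

/-- The restriction `t ↦ F (i t)` to the positive imaginary axis (only used for `t > 0`). -/
noncomputable def onImagAxis (F : ℍ → ℂ) (t : ℝ) : ℂ :=
  F (ofComplex (Complex.I * t))

/-! Write Y_k, Z_k for `extY k`, `extZ k`. Existence and uniqueness. A form of depth at most one is
A + E2·B with A, B modular (`IsDepthOne.of_isQuasimodularForm`). For F = A + E2·B ≠ 0 the expression
F² + 12(F·DB − B·DF) is a nonzero modular form of weight 2w that vanishes at least as far as F, so
the Sturm bound gives ord F ≤ ⌊w/6⌋ (`IsDepthOne.order_le`). A form with expansion q^⌊w/6⌋ + ... is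
therefore the only normalized extremal one, and the Kaneko–Koike recursion supplies such forms: Y_k,
Z_k and E₄Y_k in weights 6k, 6k+2, 6k+4 (`qExpansion_ext`).

Monotonicity is proved by induction on k (`decaysLike_ext`). The derivatives of Y_{k+1}, Z_{k+1} and
E₄Y_{k+1} are combinations, with positive coefficients, of products of forms already treated. If t^a
f and t^b g are non-increasing with f, g ≥ 0, so is t^(a+b) f g; integrating from infinity, where
the forms vanish, costs one power of t (`antitoneOn_pow_mul_of_deriv`). The exponents 5k, 5k+1,
5k+3, which equal w − ⌈w/6⌉, are reproduced exactly.

The base cases are weights 6, 8, 10. On [1, ∞) they follow from q-series with nonnegative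
coefficients. On (0, 1] the substitution t ↦ 1/t, obtained by differentiating the inversion laws of
E₄ and E₆, again gives a statement on [1, ∞). Weight 8 is the delicate one (`octic_sum_le`). -/

namespace ExtremalQuasimodular

open Filter Topology Function
open scoped Derivative
open EisensteinSeries ModularForm
open ArithmeticFunction (sigma)

/-! ### Functions with a convergent q-expansion -/

/-- Holomorphic `1`-periodic functions on the upper half-plane that are bounded at `i∞`: those with
a convergent `q`-expansion. -/
structure QExpandable (F : ℍ → ℂ) : Prop where
  mdiff : MDiff F
  bdd : IsBoundedAtImInfty F
  periodic : Periodic (F ∘ ofComplex) (1 : ℝ)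

lemma periodic_comp_ofComplex_of_vadd {F : ℍ → ℂ} (h : ∀ τ : ℍ, F ((1 : ℝ) +ᵥ τ) = F τ) :
    Periodic (F ∘ ofComplex) (1 : ℝ) := by
  intro w
  by_cases! hw : 0 < w.im
  · have h1 : 0 < (w + (1 : ℝ)).im := by simp [hw]
    simp only [comp_apply, ofComplex_apply_of_im_pos h1, ofComplex_apply_of_im_pos hw]
    rw [← h ⟨w, hw⟩]
    congr 1
    ext
    simp [add_comm]
  · have h1 : (w + (1 : ℝ)).im ≤ 0 := by simpa using hw
    simp only [comp_apply, ofComplex_apply_of_im_nonpos h1, ofComplex_apply_of_im_nonpos hw]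

/-- A function that is the sum of a convergent power series in `q` is periodic. -/
lemma periodic_of_hasSum {F : ℍ → ℂ} {c : ℕ → ℂ}
    (h : ∀ τ : ℍ, HasSum (fun m ↦ c m • Periodic.qParam 1 τ ^ m) (F τ)) :
    Periodic (F ∘ ofComplex) (1 : ℝ) := by
  refine periodic_comp_ofComplex_of_vadd fun τ ↦ ?_
  have h1 := h ((1 : ℝ) +ᵥ τ)
  have hq : Periodic.qParam 1 (((1 : ℝ) +ᵥ τ : ℍ) : ℂ) = Periodic.qParam 1 τ := by
    rw [coe_vadd, Periodic.qParam, Periodic.qParam, ← Complex.exp_periodic (_ * (τ : ℂ) / _)]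
    congr 1
    simp
    ring
  rw [hq] at h1
  exact h1.unique (h τ)

lemma QExpandable.of_hasSum {F : ℍ → ℂ} {c : ℕ → ℂ} (hF : MDiff F)
    (h : ∀ τ : ℍ, HasSum (fun m ↦ c m • Periodic.qParam 1 τ ^ m) (F τ)) : QExpandable F :=
  ⟨hF, isBoundedAtImInfty_of_hasSum_qExpansion one_pos h, periodic_of_hasSum h⟩

namespace QExpandable

variable {F G : ℍ → ℂ}

lemma analyticAt (hF : QExpandable F) : AnalyticAt ℂ (cuspFunction 1 F) 0 :=
  analyticAt_cuspFunction_zero one_pos hF.periodic hF.mdiff hF.bdd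

lemma hasSum (hF : QExpandable F) (τ : ℍ) :
    HasSum (fun m ↦ (qExpansion 1 F).coeff m • Periodic.qParam 1 τ ^ m) (F τ) :=
  hasSum_qExpansion one_pos hF.periodic hF.mdiff hF.bdd τ

lemma coeff_unique (hF : QExpandable F) {c : ℕ → ℂ}
    (h : ∀ τ : ℍ, HasSum (fun m ↦ c m • Periodic.qParam 1 τ ^ m) (F τ)) (m : ℕ) :
    (qExpansion 1 F).coeff m = c m := by
  have h1 := (hasFPowerSeriesOnBall_cuspFunction one_pos hF.analyticAt h).hasFPowerSeriesAt
  have h2 := (hasFPowerSeriesOnBall_cuspFunction one_pos hF.analyticAt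
    hF.hasSum).hasFPowerSeriesAt
  simpa using congrArg (FormalMultilinearSeries.coeff · m) (h2.eq_formalMultilinearSeries h1)

lemma add (hF : QExpandable F) (hG : QExpandable G) : QExpandable (F + G) :=
  ⟨hF.mdiff.add hG.mdiff, hF.bdd.add hG.bdd, hF.periodic.add hG.periodic⟩

lemma mul (hF : QExpandable F) (hG : QExpandable G) : QExpandable (F * G) :=
  ⟨hF.mdiff.mul hG.mdiff, hF.bdd.mul hG.bdd, hF.periodic.mul hG.periodic⟩

lemma smul (c : ℂ) (hF : QExpandable F) : QExpandable (c • F) :=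
  ⟨hF.mdiff.const_smul c, hF.bdd.const_smul_left c, fun x ↦ by
    simpa using congrArg (c * ·) (hF.periodic x)⟩

lemma sub (hF : QExpandable F) (hG : QExpandable G) : QExpandable (F - G) := by
  have h := hF.add (hG.smul (-1))
  rwa [neg_one_smul, ← sub_eq_add_neg] at h

lemma qExpansion_add (hF : QExpandable F) (hG : QExpandable G) :
    qExpansion 1 (F + G) = qExpansion 1 F + qExpansion 1 G :=
  UpperHalfPlane.qExpansion_add hF.analyticAt hG.analyticAt

lemma qExpansion_sub (hF : QExpandable F) (hG : QExpandable G) :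
    qExpansion 1 (F - G) = qExpansion 1 F - qExpansion 1 G :=
  UpperHalfPlane.qExpansion_sub hF.analyticAt hG.analyticAt

lemma qExpansion_mul (hF : QExpandable F) (hG : QExpandable G) :
    qExpansion 1 (F * G) = qExpansion 1 F * qExpansion 1 G :=
  UpperHalfPlane.qExpansion_mul hF.analyticAt hG.analyticAt

lemma qExpansion_smul (c : ℂ) (hF : QExpandable F) :
    qExpansion 1 (c • F) = c • qExpansion 1 F :=
  UpperHalfPlane.qExpansion_smul hF.analyticAt c

lemma qExpansion_eq_zero_iff (hF : QExpandable F) : qExpansion 1 F = 0 ↔ F = 0 :=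
  UpperHalfPlane.qExpansion_eq_zero_iff one_pos hF.periodic hF.mdiff hF.bdd

/-- Chain rule for F as a function of q, with dq/dτ = 2πi·q: the operator `D` becomes q·d/dq. -/
lemma normalizedDeriv_eq (hF : QExpandable F) (τ : ℍ) :
    D F τ = Periodic.qParam 1 τ * deriv (cuspFunction 1 F) (Periodic.qParam 1 τ) := by
  have hq : ‖Periodic.qParam 1 τ‖ < 1 := Periodic.norm_qParam_lt_one one_pos τ.im_pos
  have hd := (differentiableAt_cuspFunction one_pos hF.periodic hF.mdiff hF.bdd hq).hasDerivAt
  have hp : HasDerivAt (Periodic.qParam 1)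
      (2 * Real.pi * Complex.I * Periodic.qParam 1 τ) (τ : ℂ) := by
    have h1 : HasDerivAt (fun z : ℂ ↦ 2 * Real.pi * Complex.I * z / (1 : ℝ))
        (2 * Real.pi * Complex.I) (τ : ℂ) := by
      simpa using (hasDerivAt_id (τ : ℂ)).const_mul (2 * Real.pi * Complex.I)
    rw [mul_comm]
    exact h1.cexp
  have he : F ∘ ofComplex = cuspFunction 1 F ∘ Periodic.qParam 1 := by
    ext z
    exact (Periodic.eq_cuspFunction one_ne_zero hF.periodic z).symm
  rw [Derivative.normalizedDerivOfComplex, he, (hd.comp (τ : ℂ) hp).deriv]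
  have : (2 * Real.pi * Complex.I : ℂ) ≠ 0 := Complex.two_pi_I_ne_zero
  field_simp

lemma hasSum_normalizedDeriv (hF : QExpandable F) (τ : ℍ) :
    HasSum (fun m : ℕ ↦ ((m : ℂ) * (qExpansion 1 F).coeff m) • Periodic.qParam 1 τ ^ m)
      (D F τ) := by
  have hball := differentiableOn_cuspFunction_ball one_pos hF.periodic hF.mdiff hF.bdd
  have hq : Periodic.qParam 1 τ ∈ Metric.ball (0 : ℂ) 1 := by
    simpa using Periodic.norm_qParam_lt_one one_pos τ.im_pos
  have hs := (Complex.hasSum_taylorSeries_on_ball (hball.deriv Metric.isOpen_ball) hq).mul_left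
    (Periodic.qParam 1 τ)
  rw [hF.normalizedDeriv_eq, ← hasSum_nat_add_iff' 1]
  simp only [Finset.range_one, Finset.sum_singleton, Nat.cast_zero, zero_mul, zero_smul, sub_zero]
  refine hs.congr_fun fun m ↦ ?_
  have hm : ((m.factorial : ℕ) : ℂ) ≠ 0 := by exact_mod_cast m.factorial_ne_zero
  have hm1 : (m + 1 : ℂ) ≠ 0 := by exact_mod_cast m.succ_ne_zero
  rw [qExpansion_coeff, iteratedDeriv_succ', Nat.factorial_succ]
  push_cast
  simp only [smul_eq_mul, sub_zero]
  field_simp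
  ring

lemma normalizedDeriv (hF : QExpandable F) : QExpandable (D F) :=
  .of_hasSum (Derivative.normalizedDerivOfComplex_mdifferentiable hF.mdiff)
    hF.hasSum_normalizedDeriv

lemma coeff_normalizedDeriv (hF : QExpandable F) (m : ℕ) :
    (qExpansion 1 (D F)).coeff m = m * (qExpansion 1 F).coeff m :=
  hF.normalizedDeriv.coeff_unique hF.hasSum_normalizedDeriv m

/-- `F` tends to its constant `q`-coefficient at `i∞`. -/
lemma tendsto_atImInfty (hF : QExpandable F) :
    Tendsto F atImInfty (𝓝 ((qExpansion 1 F).coeff 0)) := by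
  have h := (hF.analyticAt.continuousAt.tendsto).comp (qParam_tendsto_atImInfty one_pos)
  have h0 : (qExpansion 1 F).coeff 0 = cuspFunction 1 F 0 := by simp [qExpansion_coeff]
  rw [h0]
  refine h.congr fun τ ↦ ?_
  exact eq_cuspFunction τ one_ne_zero hF.periodic

end QExpandable

/-! ### Modular forms of level one -/

lemma QExpandable.of_slash_eq {F : ℍ → ℂ} {k : ℤ} (hF : MDiff F) (hb : IsBoundedAtImInfty F)
    (h : ∀ γ : SL(2, ℤ), F ∣[k] γ = F) : QExpandable F := by
  refine ⟨hF, hb, periodic_comp_ofComplex_of_vadd fun τ ↦ ?_⟩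
  have h1 := congrFun (h ModularGroup.T) τ
  rw [SL_slash_apply, modular_T_smul] at h1
  rw [ModularGroup.denom_apply] at h1
  simpa [ModularGroup.T] using h1

/-- `F` is a modular form of weight `k` and level `SL(2, ℤ)`, as a predicate on functions. -/
def IsModularForm (k : ℤ) (F : ℍ → ℂ) : Prop :=
  QExpandable F ∧ ∀ γ : SL(2, ℤ), F ∣[k] γ = F

namespace IsModularForm

variable {F G : ℍ → ℂ} {k l : ℤ}

lemma exists_modularForm (hF : IsModularForm k F) : ∃ f : ModularForm 𝒮ℒ k, (f : ℍ → ℂ) = F :=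
  ⟨{ toFun := F
     slash_action_eq' := fun _ ⟨γ, hγ⟩ ↦ hγ ▸ hF.2 γ
     holo' := hF.1.mdiff
     bdd_at_cusps' := fun {c} hc ↦ by
        rw [Subgroup.IsArithmetic.isCusp_iff_isCusp_SL2Z] at hc
        rw [OnePoint.isBoundedAt_iff_forall_SL2Z hc]
        intro γ _
        exact (hF.2 γ).symm ▸ hF.1.bdd }, rfl⟩

lemma of_modularForm (f : ModularForm 𝒮ℒ k) : IsModularForm k f :=
  have hs : ∀ γ : SL(2, ℤ), (f : ℍ → ℂ) ∣[k] γ = f := fun γ ↦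
    SlashInvariantForm.slash_action_eqn f _ ⟨γ, rfl⟩
  ⟨.of_slash_eq (ModularFormClass.holo f) (ModularFormClass.bdd_at_infty f) hs, hs⟩

lemma add (hF : IsModularForm k F) (hG : IsModularForm k G) : IsModularForm k (F + G) :=
  ⟨hF.1.add hG.1, fun γ ↦ by rw [SlashAction.add_slash, hF.2, hG.2]⟩

lemma smul (c : ℂ) (hF : IsModularForm k F) : IsModularForm k (c • F) :=
  ⟨hF.1.smul c, fun γ ↦ by rw [SL_smul_slash, hF.2]⟩

lemma sub (hF : IsModularForm k F) (hG : IsModularForm k G) : IsModularForm k (F - G) := by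
  have h := hF.add (hG.smul (-1))
  rwa [neg_one_smul, ← sub_eq_add_neg] at h

lemma mul (hF : IsModularForm k F) (hG : IsModularForm l G) : IsModularForm (k + l) (F * G) :=
  ⟨hF.1.mul hG.1, fun γ ↦ by rw [mul_slash_SL2, hF.2, hG.2]⟩

/-- The Sturm bound in level one. -/
lemma order_le (hF : IsModularForm k F) (h0 : F ≠ 0) :
    (qExpansion 1 F).order ≤ (k.toNat / 12 : ℕ) := by
  obtain ⟨f, rfl⟩ := hF.exists_modularForm
  by_contra! h
  exact h0 (by simp [sturm_bound_levelOne h])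

/-- Modular forms of weight less than `12` are determined by their constant coefficient. -/
lemma eq_of_coeff_zero_eq (hk : k < 12) (hF : IsModularForm k F) (hG : IsModularForm k G)
    (h : (qExpansion 1 F).coeff 0 = (qExpansion 1 G).coeff 0) : F = G := by
  by_contra hne
  have h1 := (hF.sub hG).order_le (sub_ne_zero.mpr hne)
  rw [show k.toNat / 12 = 0 by omega, Nat.cast_zero, nonpos_iff_eq_zero] at h1
  have h2 : (qExpansion 1 (F - G)).coeff 0 = 0 := by
    rw [hF.1.qExpansion_sub hG.1, map_sub, h, sub_self]
  have h3 := PowerSeries.order_eq_nat.mp (show (qExpansion 1 (F - G)).order = (0 : ℕ) by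
    simpa using h1)
  exact h3.1 h2

end IsModularForm

/-! ### Eisenstein series and Ramanujan's identities -/

lemma hasSum_E2 (τ : ℍ) : HasSum (fun m : ℕ ↦
    (if m = 0 then 1 else -24 * ArithmeticFunction.sigma 1 m : ℂ) • Periodic.qParam 1 τ ^ m)
    (E2 τ) := by
  simpa only [Periodic.qParam, Complex.ofReal_one, div_one] using hasSum_qExpansion_E2 (z := τ)

lemma qExpandable_E2 : QExpandable E2 := .of_hasSum E2_mdifferentiable hasSum_E2

lemma coeff_E2 (m : ℕ) : (qExpansion 1 E2).coeff m =
    if m = 0 then 1 else -24 * (ArithmeticFunction.sigma 1 m : ℂ) :=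
  qExpandable_E2.coeff_unique hasSum_E2 m

lemma isModularForm_E4 : IsModularForm 4 E₄ := .of_modularForm E₄

lemma isModularForm_E6 : IsModularForm 6 E₆ := .of_modularForm E₆

lemma coeff_E4 (m : ℕ) : (qExpansion 1 E₄).coeff m =
    if m = 0 then 1 else 240 * (ArithmeticFunction.sigma 3 m : ℂ) := by
  rw [E_qExpansion_coeff _ ⟨2, rfl⟩, show bernoulli 4 = -1 / 30 by decide +kernel]
  norm_num

lemma coeff_E6 (m : ℕ) : (qExpansion 1 E₆).coeff m =
    if m = 0 then 1 else -504 * (ArithmeticFunction.sigma 5 m : ℂ) := by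
  rw [E_qExpansion_coeff _ ⟨3, rfl⟩, show bernoulli 6 = 1 / 42 by decide +kernel]
  norm_num

/-- The factor `c / (c z + d)` that measures the failure of modularity. -/
noncomputable def cocycle (γ : SL(2, ℤ)) (z : ℍ) : ℂ := ((γ 1 0 : ℤ) : ℂ) / denom γ z

/-- The constant `12 / (2 π i)` in the transformation law of `E2`. -/
noncomputable def kappa : ℂ := 12 * (2 * Real.pi * Complex.I)⁻¹

lemma kappa_ne_zero : kappa ≠ 0 :=
  mul_ne_zero (by norm_num) (inv_ne_zero Complex.two_pi_I_ne_zero)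

lemma E2_slash (γ : SL(2, ℤ)) : E2 ∣[(2 : ℤ)] γ = E2 + kappa • cocycle γ := by
  rw [E2_slash_action]
  ext z
  have hpi : (Real.pi : ℂ) ≠ 0 := by exact_mod_cast Real.pi_ne_zero
  simp only [D2, cocycle, kappa, riemannZeta_two, Pi.sub_apply, Pi.add_apply, Pi.smul_apply,
    smul_eq_mul]
  have hd := denom_ne_zero γ z
  field_simp
  ring_nf
  simp [Complex.I_sq]

lemma hasDerivAt_cocycle (γ : SL(2, ℤ)) (z : ℍ) :
    HasDerivAt (cocycle γ ∘ ofComplex) (-cocycle γ z ^ 2) z := by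
  have hd := denom_ne_zero γ z
  rw [ModularGroup.denom_apply] at hd
  have h1 : HasDerivAt (fun w : ℂ ↦ ((γ 1 0 : ℤ) : ℂ) / ((γ 1 0 : ℤ) * w + (γ 1 1 : ℤ)))
      (-cocycle γ z ^ 2) z := by
    have h2 := (hasDerivAt_const (z : ℂ) ((γ 1 0 : ℤ) : ℂ)).div
      (((hasDerivAt_id (z : ℂ)).const_mul ((γ 1 0 : ℤ) : ℂ)).add_const ((γ 1 1 : ℤ) : ℂ)) hd
    convert! h2 using 1
    rw [cocycle, ModularGroup.denom_apply]
    simp only [id]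
    field_simp
    ring
  refine h1.congr_of_eventuallyEq ?_
  filter_upwards [isOpen_upperHalfPlaneSet.mem_nhds z.im_pos] with w hw
  have hw' : 0 < w.im := hw
  rw [comp_apply, ofComplex_apply_of_im_pos hw', cocycle, ModularGroup.denom_apply]

lemma mdiff_cocycle (γ : SL(2, ℤ)) : MDiff (cocycle γ) := fun z ↦
  mdifferentiableAt_iff.mpr (hasDerivAt_cocycle γ z).differentiableAt

lemma normalizedDeriv_cocycle (γ : SL(2, ℤ)) (z : ℍ) :
    D (cocycle γ) z = -(2 * Real.pi * Complex.I)⁻¹ * cocycle γ z ^ 2 := by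
  rw [Derivative.normalizedDerivOfComplex, (hasDerivAt_cocycle γ z).deriv]
  ring

/-- Under the slash action both D E2 and E2²/12 acquire the same extra terms, one linear and one
quadratic in `cocycle γ`, because D of the cocycle is −(κ/12) times its square. -/
lemma isModularForm_E2_aux : IsModularForm 4 (D E2 - (12⁻¹ : ℂ) • (E2 * E2)) := by
  refine ⟨qExpandable_E2.normalizedDeriv.sub ((qExpandable_E2.mul qExpandable_E2).smul _),
    fun γ ↦ ?_⟩
  have h1 := Derivative.normalizedDerivOfComplex_SL_slash (k := 2) (γ := γ) E2_mdifferentiable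
  rw [E2_slash, Derivative.normalizedDerivOfComplex_add _ _ E2_mdifferentiable
    ((mdiff_cocycle γ).const_smul kappa), Derivative.normalizedDerivOfComplex_smul _ _
    (mdiff_cocycle γ)] at h1
  have h2 := mul_slash_SL2 2 2 γ E2 E2
  rw [E2_slash] at h2
  ext z
  have h3 := congrFun h1 z
  have h4 := congrFun h2 z
  rw [show D E2 - (12⁻¹ : ℂ) • (E2 * E2) = D E2 + (-12⁻¹ : ℂ) • (E2 * E2) by
    module, SlashAction.add_slash, SL_smul_slash]
  simp only [Pi.add_apply, Pi.sub_apply, Pi.smul_apply, Pi.mul_apply, smul_eq_mul,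
    normalizedDeriv_cocycle, Int.reduceAdd] at h3 h4 ⊢
  rw [h4]
  rw [show ((γ 1 0 : ℤ) : ℂ) / denom γ z = cocycle γ z from rfl] at h3
  rw [show (2 * Real.pi * Complex.I : ℂ)⁻¹ = kappa / 12 by rw [kappa]; ring] at h3
  push_cast at h3
  linear_combination -h3

/-- Below weight 12 a modular form is fixed by its constant coefficient, so each of Ramanujan's
identities reduces to comparing one number. -/
lemma ramanujan_E2 : D E2 = (12⁻¹ : ℂ) • (E2 * E2 - E₄) := by
  have h : D E2 - (12⁻¹ : ℂ) • (E2 * E2) = (-12⁻¹ : ℂ) • (E₄ : ℍ → ℂ) := by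
    refine isModularForm_E2_aux.eq_of_coeff_zero_eq (by norm_num) (isModularForm_E4.smul _) ?_
    rw [qExpandable_E2.normalizedDeriv.qExpansion_sub ((qExpandable_E2.mul qExpandable_E2).smul _),
      (qExpandable_E2.mul qExpandable_E2).qExpansion_smul, qExpandable_E2.qExpansion_mul
      qExpandable_E2, isModularForm_E4.1.qExpansion_smul, map_sub, PowerSeries.coeff_smul,
      PowerSeries.coeff_smul, qExpandable_E2.coeff_normalizedDeriv, PowerSeries.coeff_mul, coeff_E4]
    simp [coeff_E2, -PowerSeries.coeff_zero_eq_constantCoeff]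
  rw [sub_eq_iff_eq_add.mp h]
  module

lemma IsModularForm.serreDerivative {k : ℤ} {F : ℍ → ℂ} (hF : IsModularForm k F) :
    IsModularForm (k + 2) (Derivative.serreDerivative k F) := by
  refine ⟨?_, fun γ ↦ Derivative.serreDerivative_slash_invariant hF.1.mdiff (hF.2 γ)⟩
  have h : Derivative.serreDerivative k F = D F - ((k : ℂ) * 12⁻¹) • (E2 * F) := by
    ext z
    simp [mul_assoc]
  rw [h]
  exact hF.1.normalizedDeriv.sub ((qExpandable_E2.mul hF.1).smul _)

lemma coeff_zero_serreDerivative {k : ℤ} {F : ℍ → ℂ} (hF : QExpandable F) :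
    (qExpansion 1 (Derivative.serreDerivative k F)).coeff 0 =
      -(k * 12⁻¹) * (qExpansion 1 F).coeff 0 := by
  have h : Derivative.serreDerivative k F = D F - ((k : ℂ) * 12⁻¹) • (E2 * F) := by
    ext z
    simp [mul_assoc]
  rw [h, hF.normalizedDeriv.qExpansion_sub ((qExpandable_E2.mul hF).smul _),
    (qExpandable_E2.mul hF).qExpansion_smul, qExpandable_E2.qExpansion_mul hF, map_sub,
    PowerSeries.coeff_smul, hF.coeff_normalizedDeriv, PowerSeries.coeff_mul]
  simp [coeff_E2, -PowerSeries.coeff_zero_eq_constantCoeff]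

lemma ramanujan_E4 : D E₄ = (3⁻¹ : ℂ) • (E2 * E₄ - E₆) := by
  have h : Derivative.serreDerivative (4 : ℤ) E₄ = (-3⁻¹ : ℂ) • (E₆ : ℍ → ℂ) := by
    refine isModularForm_E4.serreDerivative.eq_of_coeff_zero_eq (by norm_num)
      (isModularForm_E6.smul _) ?_
    rw [coeff_zero_serreDerivative isModularForm_E4.1, isModularForm_E6.1.qExpansion_smul,
      PowerSeries.coeff_smul, coeff_E4, coeff_E6]
    norm_num
  ext z
  have hz := congrFun h z
  simp only [Derivative.serreDerivative_apply, Pi.smul_apply, Pi.sub_apply, Pi.mul_apply,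
    smul_eq_mul] at hz ⊢
  push_cast at hz
  linear_combination hz

lemma ramanujan_E6 : D E₆ = (2⁻¹ : ℂ) • (E2 * E₆ - E₄ * E₄) := by
  have h : Derivative.serreDerivative (6 : ℤ) E₆ = (-2⁻¹ : ℂ) • (E₄ * E₄ : ℍ → ℂ) := by
    refine isModularForm_E6.serreDerivative.eq_of_coeff_zero_eq (by norm_num)
      ((isModularForm_E4.mul isModularForm_E4).smul _) ?_
    rw [coeff_zero_serreDerivative isModularForm_E6.1,
      (isModularForm_E4.mul isModularForm_E4).1.qExpansion_smul,
      isModularForm_E4.1.qExpansion_mul isModularForm_E4.1,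
      PowerSeries.coeff_smul, PowerSeries.coeff_mul, coeff_E6]
    norm_num [coeff_E4, -PowerSeries.coeff_zero_eq_constantCoeff]
  ext z
  have hz := congrFun h z
  simp only [Derivative.serreDerivative_apply, Pi.smul_apply, Pi.sub_apply, Pi.mul_apply,
    smul_eq_mul] at hz ⊢
  push_cast at hz
  linear_combination hz

/-! ### The operator `q d/dq` on power series -/

open PowerSeries in
/-- The operator `q d/dq` on formal power series. -/
noncomputable def qDeriv (p : PowerSeries ℂ) : PowerSeries ℂ := X * derivative ℂ p

lemma coeff_qDeriv (p : PowerSeries ℂ) (n : ℕ) : (qDeriv p).coeff n = n * p.coeff n := by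
  cases n with
  | zero => simp [qDeriv]
  | succ n =>
    rw [qDeriv, PowerSeries.coeff_succ_X_mul, PowerSeries.coeff_derivative]
    push_cast
    ring

lemma QExpandable.qExpansion_normalizedDeriv {F : ℍ → ℂ} (hF : QExpandable F) :
    qExpansion 1 (D F) = qDeriv (qExpansion 1 F) := by
  ext n
  rw [hF.coeff_normalizedDeriv, coeff_qDeriv]

open PowerSeries in
lemma qDeriv_X_pow_mul (n : ℕ) (u : PowerSeries ℂ) :
    qDeriv (X ^ n * u) = X ^ n * (C (n : ℂ) * u + qDeriv u) := by
  simp only [qDeriv, Derivation.leibniz, smul_eq_mul, PowerSeries.derivative_pow,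
    PowerSeries.derivative_X]
  cases n with
  | zero => simp
  | succ n =>
    simp
    ring

open PowerSeries in
-- Let p, b have orders n, m and leading coefficients u₀, v₀. For n ≤ m the coefficient of X^(2n) is
-- u₀², since when n = m the leading terms of the Wronskian cancel. For n > m the coefficient of
-- X^(n+m) is 12(m − n)u₀v₀. Neither can vanish.
lemma eq_zero_of_wronskian_eq_zero {p b : PowerSeries ℂ}
    (h : p ^ 2 + 12 * (p * qDeriv b - b * qDeriv p) = 0) : p = 0 := by
  by_contra hp
  have hb : b ≠ 0 := by
    rintro rfl
    simp [qDeriv, hp] at h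
  obtain ⟨n, u, hu, rfl⟩ : ∃ (n : ℕ) (u : PowerSeries ℂ), constantCoeff u ≠ 0 ∧ p = X ^ n * u :=
    ⟨_, _, mt constantCoeff_divXPowOrder_eq_zero_iff.mp hp, X_pow_order_mul_divXPowOrder.symm⟩
  obtain ⟨m, v, hv, rfl⟩ : ∃ (n : ℕ) (u : PowerSeries ℂ), constantCoeff u ≠ 0 ∧ b = X ^ n * u :=
    ⟨_, _, mt constantCoeff_divXPowOrder_eq_zero_iff.mp hb, X_pow_order_mul_divXPowOrder.symm⟩
  have hθ : ∀ w : PowerSeries ℂ, constantCoeff (qDeriv w) = 0 := fun w ↦ by simp [qDeriv]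
  have hX : ∀ k : ℕ, (X : PowerSeries ℂ) ^ k ≠ 0 := fun k ↦ pow_ne_zero k X_ne_zero
  rw [qDeriv_X_pow_mul, qDeriv_X_pow_mul] at h
  rcases le_total n m with hnm | hnm
  · obtain ⟨d, rfl⟩ := Nat.exists_eq_add_of_le hnm
    have h1 : u ^ 2 + 12 * (X ^ d * (u * (C ((n + d : ℕ) : ℂ) * v + qDeriv v)
        - v * (C (n : ℂ) * u + qDeriv u))) = 0 := by
      refine (mul_eq_zero.mp ?_).resolve_left (hX (2 * n))
      rw [← h]
      ring
    have h2 := congrArg (constantCoeff (R := ℂ)) h1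
    simp only [map_add, map_mul, map_sub, map_pow, hθ, constantCoeff_X, map_zero] at h2
    rcases Nat.eq_zero_or_pos d with rfl | hd
    · simp only [pow_zero, one_mul] at h2
      have : constantCoeff u ^ 2 = 0 := by linear_combination h2
      exact hu (by simpa using this)
    · simp [hu, hd.ne'] at h2
  · obtain ⟨d, rfl⟩ := Nat.exists_eq_add_of_le hnm
    rcases Nat.eq_zero_or_pos d with rfl | hd
    · have h1 : u ^ 2 + 12 * (u * qDeriv v - v * qDeriv u) = 0 := by
        refine (mul_eq_zero.mp ?_).resolve_left (hX (2 * m))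
        rw [← h, add_zero]
        ring
      have h2 := congrArg (constantCoeff (R := ℂ)) h1
      simp [hθ, hu] at h2
    · have h1 : X ^ d * u ^ 2 + 12 * (u * (C (m : ℂ) * v + qDeriv v)
          - v * (C ((m + d : ℕ) : ℂ) * u + qDeriv u)) = 0 := by
        refine (mul_eq_zero.mp ?_).resolve_left (hX (2 * m + d))
        rw [← h]
        ring
      have h2 := congrArg (constantCoeff (R := ℂ)) h1
      simp only [map_add, map_mul, map_sub, map_pow, hθ, constantCoeff_X, map_zero,
        zero_pow hd.ne', constantCoeff_C] at h2
      have h3 : (d : ℂ) * (constantCoeff u * constantCoeff v) = 0 := by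
        push_cast at h2
        have h12 : constantCoeff (12 : PowerSeries ℂ) = (12 : ℂ) := map_ofNat _ 12
        rw [h12] at h2
        linear_combination -h2 / 12
      simp [hu, hv, hd.ne'] at h3

/-! ### Quasimodular forms of depth one -/

/-- `F = A + E2 * B` with modular forms `A` of weight `w` and `B` of weight `w - 2`. -/
def IsDepthOne (w : ℤ) (F : ℍ → ℂ) : Prop :=
  ∃ A B : ℍ → ℂ, IsModularForm w A ∧ IsModularForm (w - 2) B ∧ F = A + E2 * B

lemma cocycle_S_ne_zero (z : ℍ) : cocycle ModularGroup.S z ≠ 0 := by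
  refine div_ne_zero ?_ (denom_ne_zero _ z)
  simp [ModularGroup.S]

/-- Up to κ the cocycle is the coboundary E2∣γ − E2, which makes the cocycle relation automatic. -/
lemma cocycle_mul (γ δ : SL(2, ℤ)) :
    cocycle (γ * δ) = cocycle γ ∣[(2 : ℤ)] δ + cocycle δ := by
  have h := SlashAction.slash_mul (2 : ℤ) γ δ E2
  rw [E2_slash, E2_slash, SlashAction.add_slash, E2_slash, SL_smul_slash, add_assoc,
    add_right_inj, ← smul_add] at h
  have h2 := smul_right_injective _ kappa_ne_zero h
  rw [h2, add_comm]

lemma slash_E2_mul {w : ℤ} {B : ℍ → ℂ} (γ : SL(2, ℤ)) :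
    (E2 * B) ∣[w] γ = (E2 + kappa • cocycle γ) * (B ∣[w - 2] γ) := by
  have h := mul_slash_SL2 2 (w - 2) γ E2 B
  rwa [E2_slash, add_sub_cancel] at h

namespace IsDepthOne

variable {F G : ℍ → ℂ} {w k : ℤ}

lemma qExpandable (hF : IsDepthOne w F) : QExpandable F := by
  obtain ⟨A, B, hA, hB, rfl⟩ := hF
  exact hA.1.add (qExpandable_E2.mul hB.1)

lemma sub (hF : IsDepthOne w F) (hG : IsDepthOne w G) : IsDepthOne w (F - G) := by
  obtain ⟨A, B, hA, hB, rfl⟩ := hF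
  obtain ⟨A', B', hA', hB', rfl⟩ := hG
  exact ⟨A - A', B - B', hA.sub hA', hB.sub hB', by ring⟩

lemma smul (c : ℂ) (hF : IsDepthOne w F) : IsDepthOne w (c • F) := by
  obtain ⟨A, B, hA, hB, rfl⟩ := hF
  exact ⟨c • A, c • B, hA.smul c, hB.smul c, by rw [smul_add, mul_smul_comm]⟩

lemma mul_left (hG : IsModularForm k G) (hF : IsDepthOne w F) : IsDepthOne (k + w) (G * F) := by
  obtain ⟨A, B, hA, hB, rfl⟩ := hF
  exact ⟨G * A, G * B, hG.mul hA, by simpa only [add_sub_assoc] using hG.mul hB, by ring⟩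

lemma isQuasimodularForm (hF : IsDepthOne w F) : IsQuasimodularForm w 1 F := by
  refine ⟨hF.qExpandable.mdiff, ?_⟩
  have hq := hF.qExpandable
  obtain ⟨A, B, hA, hB, rfl⟩ := hF
  refine ⟨![A + E2 * B, kappa • B], ?_, ?_, fun γ z ↦ ?_⟩
  · simpa [Fin.forall_fin_two] using ⟨hq.mdiff, (hB.1.smul kappa).mdiff⟩
  · simpa [Fin.forall_fin_two] using ⟨hq.bdd, (hB.1.smul kappa).bdd⟩
  · rw [SlashAction.add_slash, slash_E2_mul, hA.2, hB.2, Fin.sum_univ_two]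
    rw [show ((γ 1 0 : ℤ) : ℂ) / denom γ z = cocycle γ z from rfl]
    simp
    ring

/-- Expanding F∣(Sγ) in two ways leaves (f₁∣γ − f₁)·(cocycle S∣γ) = 0. The cocycle of S has no
zeros, so f₁ is modular of weight w − 2, and subtracting κ⁻¹·E2·f₁ from F removes its failure of
modularity. -/
lemma of_isQuasimodularForm (hF : IsQuasimodularForm w 1 F) : IsDepthOne w F := by
  obtain ⟨hmd, f, hf, hb, h⟩ := hF
  have hslash : ∀ γ : SL(2, ℤ), F ∣[w] γ = f 0 + f 1 * cocycle γ := fun γ ↦ by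
    ext z
    rw [h γ z, Fin.sum_univ_two]
    simp [cocycle]
  have h0 : f 0 = F := by
    have h1 := hslash 1
    rw [SlashAction.slash_one] at h1
    rw [h1]
    ext z
    simp [cocycle]
  rw [h0] at hslash
  have h1 : ∀ γ : SL(2, ℤ), f 1 ∣[w - 2] γ = f 1 := fun γ ↦ by
    have h2 := SlashAction.slash_mul w ModularGroup.S γ F
    have h3 := mul_slash_SL2 (w - 2) 2 γ (f 1) (cocycle ModularGroup.S)
    rw [sub_add_cancel] at h3
    rw [hslash, hslash, SlashAction.add_slash, hslash, h3, cocycle_mul] at h2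
    have h4 : (f 1 ∣[w - 2] γ - f 1) * cocycle ModularGroup.S ∣[(2 : ℤ)] γ = 0 := by
      linear_combination -h2
    ext z
    have h5 := congrFun h4 z
    have h6 : (cocycle ModularGroup.S ∣[(2 : ℤ)] γ) z ≠ 0 := by
      rw [SL_slash_apply]
      exact mul_ne_zero (cocycle_S_ne_zero _) (zpow_ne_zero _ (denom_ne_zero _ _))
    simpa [sub_eq_zero, h6] using h5
  have hB : IsModularForm (w - 2) (kappa⁻¹ • f 1) :=
    IsModularForm.smul _ ⟨.of_slash_eq (hf 1) (hb 1) h1, h1⟩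
  have hA : ∀ γ : SL(2, ℤ), (F - E2 * (kappa⁻¹ • f 1)) ∣[w] γ = F - E2 * (kappa⁻¹ • f 1) :=
    fun γ ↦ by
    have h2 : F - E2 * (kappa⁻¹ • f 1) = F + (-1 : ℂ) • (E2 * (kappa⁻¹ • f 1)) := by
      rw [neg_one_smul, sub_eq_add_neg]
    rw [h2, SlashAction.add_slash, SL_smul_slash, slash_E2_mul, hB.2, hslash]
    ext z
    have := kappa_ne_zero
    simp
    field_simp
    ring
  refine ⟨F - E2 * (kappa⁻¹ • f 1), kappa⁻¹ • f 1, ⟨.of_slash_eq ?_ ?_ hA, hA⟩, hB, by ring⟩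
  · exact hmd.sub (qExpandable_E2.mul hB.1).mdiff
  · exact (h0 ▸ hb 0).sub (qExpandable_E2.mul hB.1).bdd

/-- A nonzero quasimodular form of weight `w` and depth at most one vanishes to order at most
`w / 6` at `i∞`. -/
lemma order_le (hw : 0 ≤ w) (hF : IsDepthOne w F) (h0 : F ≠ 0) :
    (qExpansion 1 F).order ≤ (w.toNat / 6 : ℕ) := by
  have hFq := hF.qExpandable
  obtain ⟨A, B, hA, hB, hFAB⟩ := hF
  set W : ℍ → ℂ := F * F + (12 : ℂ) • (F * D B - B * D F) with hW
  have hWq : qExpansion 1 W = qExpansion 1 F ^ 2 + 12 *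
      (qExpansion 1 F * qDeriv (qExpansion 1 B) - qExpansion 1 B * qDeriv (qExpansion 1 F)) := by
    have h1 := hFq.mul hB.1.normalizedDeriv
    have h2 := hB.1.mul hFq.normalizedDeriv
    rw [hW, (hFq.mul hFq).qExpansion_add ((h1.sub h2).smul _), (h1.sub h2).qExpansion_smul,
      h1.qExpansion_sub h2, hFq.qExpansion_mul hFq, hFq.qExpansion_mul hB.1.normalizedDeriv,
      hB.1.qExpansion_mul hFq.normalizedDeriv, hB.1.qExpansion_normalizedDeriv,
      hFq.qExpansion_normalizedDeriv, PowerSeries.smul_eq_C_mul, map_ofNat]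
    ring
  have hWm : IsModularForm (w + w) W := by
    have h1 := hA.mul hB.serreDerivative
    have h2 := hB.mul hA.serreDerivative
    have h3 := isModularForm_E4.mul (hB.mul hB)
    rw [show w + (w - 2 + 2) = w + w by ring] at h1
    rw [show w - 2 + (w + 2) = w + w by ring] at h2
    rw [show 4 + (w - 2 + (w - 2)) = w + w by ring] at h3
    -- With ϑ the Serre derivative, all terms containing E2 cancel and W = A² + E₄B² + 12(A·ϑB −
    -- B·ϑA).
    have h4 := ((hA.mul hA).add h3).add ((h1.sub h2).smul 12)
    convert! h4 using 1
    have hDF : D F = D A + (D E2 * B + E2 * D B) := by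
      rw [hFAB, Derivative.normalizedDerivOfComplex_add _ _ hA.1.mdiff
        (qExpandable_E2.mul hB.1).mdiff, Derivative.normalizedDerivOfComplex_mul _ _
        E2_mdifferentiable hB.1.mdiff]
    rw [hW, hDF, ramanujan_E2, hFAB]
    ext z
    simp
    ring
  have hW0 : W ≠ 0 := by
    intro h
    rw [h, qExpansion_zero] at hWq
    exact h0 (hFq.qExpansion_eq_zero_iff.mp (eq_zero_of_wronskian_eq_zero hWq.symm))
  have hle := hWm.order_le hW0
  rw [show (w + w).toNat / 12 = w.toNat / 6 by omega] at hle
  refine le_trans ?_ hle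
  have hp : qExpansion 1 F ≠ 0 := mt hFq.qExpansion_eq_zero_iff.mp h0
  -- Every term of W has F or DF as a factor, and q·d/dq preserves divisibility by X^n.
  have hdvd : (PowerSeries.X : PowerSeries ℂ) ^ (qExpansion 1 F).order.toNat ∣ qExpansion 1 W := by
    obtain ⟨u, hu⟩ := (qExpansion 1 F).X_pow_order_dvd
    generalize (qExpansion 1 F).order.toNat = n at hu ⊢
    rw [hWq, hu, qDeriv_X_pow_mul]
    refine dvd_add ⟨PowerSeries.X ^ n * u ^ 2, by ring⟩ (dvd_mul_of_dvd_right (dvd_sub ?_ ?_) _)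
    · exact ⟨_, mul_assoc _ _ _⟩
    · exact ⟨_, mul_left_comm _ _ _⟩
  rw [PowerSeries.X_pow_dvd_iff] at hdvd
  have h := PowerSeries.nat_le_order _ _ hdvd
  rwa [ENat.natCast_toNat (by simpa [PowerSeries.order_eq_top] using hp)] at h

end IsDepthOne

/-- A quasimodular form of depth at most one with `q`-expansion `q ^ (w / 6) + ...` is the unique
normalized extremal one. -/
lemma isNormalizedExtremal_of_leading {w : ℤ} (hw : 0 ≤ w) {X : ℍ → ℂ} (hX : IsDepthOne w X)
    (h0 : ∀ i < w.toNat / 6, (qExpansion 1 X).coeff i = 0)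
    (h1 : (qExpansion 1 X).coeff (w.toNat / 6) = 1) :
    IsNormalizedExtremal w 1 X ∧ ∀ Y : ℍ → ℂ, IsNormalizedExtremal w 1 Y → Y = X := by
  have hord : orderAtInfty X = (w.toNat / 6 : ℕ) :=
    PowerSeries.order_eq_nat.mpr ⟨by simp [h1], h0⟩
  have hne : X ≠ 0 := by
    rintro rfl
    simp [qExpansion_zero] at h1
  refine ⟨⟨⟨hX.isQuasimodularForm, hne, fun G hG hG0 ↦ ?_⟩, ?_⟩, fun Y hY ↦ ?_⟩
  · rw [hord]
    exact (IsDepthOne.of_isQuasimodularForm hG).order_le hw hG0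
  · rw [hord, ENat.toNat_natCast, h1]
  · obtain ⟨⟨hYq, hY0, hYmax⟩, hYc⟩ := hY
    have hYd := IsDepthOne.of_isQuasimodularForm hYq
    have hYord : orderAtInfty Y = (w.toNat / 6 : ℕ) :=
      le_antisymm (hYd.order_le hw hY0) (hord ▸ hYmax X hX.isQuasimodularForm hne)
    rw [hYord, ENat.toNat_natCast] at hYc
    by_contra hne'
    -- The leading terms of Y and X cancel, so a nonzero Y − X would vanish beyond the bound.
    have hle := (hYd.sub hX).order_le hw (sub_ne_zero.mpr hne')
    have hlt : ((w.toNat / 6 + 1 : ℕ) : ℕ∞) ≤ (qExpansion 1 (Y - X)).order := by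
      refine PowerSeries.nat_le_order _ _ fun i hi ↦ ?_
      rw [hYd.qExpandable.qExpansion_sub hX.qExpandable, map_sub]
      rcases Nat.lt_succ_iff_lt_or_eq.mp hi with h | rfl
      · rw [h0 i h, (PowerSeries.order_eq_nat.mp hYord).2 i h, sub_zero]
      · rw [h1, hYc, sub_self]
    have := hlt.trans hle
    rw [Nat.cast_le] at this
    omega

/-! ### The recursive construction of the extremal forms of depth one -/

/-- The extremal forms of weights `6 k` and `6 k + 2`, by the recursion of Kaneko and Koike. -/
noncomputable def extremalPair : ℕ → (ℍ → ℂ) × (ℍ → ℂ)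
  | 0 => (1, E2)
  | k + 1 =>
    (((6 * k + 6 : ℂ) / (864 * (6 * k + 5))) •
        (E₄ * (extremalPair k).2 - E₆ * (extremalPair k).1),
      ((6 * k + 6 : ℂ) / (864 * (6 * k + 7))) •
        (E₄ * (E₄ * (extremalPair k).1) - E₆ * (extremalPair k).2))

/-- The extremal form of weight `6 k`. -/
noncomputable def extY (k : ℕ) : ℍ → ℂ := (extremalPair k).1

/-- The extremal form of weight `6 k + 2`. -/
noncomputable def extZ (k : ℕ) : ℍ → ℂ := (extremalPair k).2

lemma extY_zero : extY 0 = 1 := rfl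

lemma extZ_zero : extZ 0 = E2 := rfl

lemma extY_succ (k : ℕ) : extY (k + 1) =
    ((6 * k + 6 : ℂ) / (864 * (6 * k + 5))) • (E₄ * extZ k - E₆ * extY k) := rfl

lemma extZ_succ (k : ℕ) : extZ (k + 1) =
    ((6 * k + 6 : ℂ) / (864 * (6 * k + 7))) • (E₄ * (E₄ * extY k) - E₆ * extZ k) := rfl

lemma isModularForm_one : IsModularForm 0 (1 : ℍ → ℂ) := by
  have h := IsModularForm.of_modularForm (1 : ModularForm 𝒮ℒ 0)
  rwa [ModularForm.one_coe_eq_one] at h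

lemma isModularForm_zero (k : ℤ) : IsModularForm k (0 : ℍ → ℂ) :=
  IsModularForm.of_modularForm (0 : ModularForm 𝒮ℒ k)

lemma isDepthOne_ext (k : ℕ) : IsDepthOne (6 * k) (extY k) ∧ IsDepthOne (6 * k + 2) (extZ k) := by
  induction k with
  | zero =>
    refine ⟨⟨1, 0, by simpa using isModularForm_one, isModularForm_zero _, ?_⟩,
      ⟨0, 1, isModularForm_zero _, by simpa using isModularForm_one, ?_⟩⟩
    · simp [extY_zero]
    · simp [extZ_zero]
  | succ k ih =>
    have h1 := ih.2.mul_left isModularForm_E4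
    have h2 := ih.1.mul_left isModularForm_E6
    have h3 := (ih.1.mul_left isModularForm_E4).mul_left isModularForm_E4
    have h4 := ih.2.mul_left isModularForm_E6
    rw [show (4 : ℤ) + (6 * k + 2) = 6 * (k + 1 : ℕ) by push_cast; ring] at h1
    rw [show (6 : ℤ) + 6 * k = 6 * (k + 1 : ℕ) by push_cast; ring] at h2
    rw [show (4 : ℤ) + (4 + 6 * k) = 6 * (k + 1 : ℕ) + 2 by push_cast; ring] at h3
    rw [show (6 : ℤ) + (6 * k + 2) = 6 * (k + 1 : ℕ) + 2 by push_cast; ring] at h4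
    exact ⟨(h1.sub h2).smul _, (h3.sub h4).smul _⟩

lemma qExpandable_extY (k : ℕ) : QExpandable (extY k) := (isDepthOne_ext k).1.qExpandable

lemma qExpandable_extZ (k : ℕ) : QExpandable (extZ k) := (isDepthOne_ext k).2.qExpandable

lemma qExpandable_E4 : QExpandable E₄ := isModularForm_E4.1

lemma qExpandable_E6 : QExpandable E₆ := isModularForm_E6.1

lemma normalizedDeriv_E4_mul_sub {Y Z : ℍ → ℂ} (hY : QExpandable Y) (hZ : QExpandable Z) :
    D (E₄ * Z - E₆ * Y) = D E₄ * Z + E₄ * D Z - (D E₆ * Y + E₆ * D Y) := by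
  rw [Derivative.normalizedDerivOfComplex_sub _ _ (qExpandable_E4.mul hZ).mdiff
    (qExpandable_E6.mul hY).mdiff, Derivative.normalizedDerivOfComplex_mul _ _
    qExpandable_E4.mdiff hZ.mdiff, Derivative.normalizedDerivOfComplex_mul _ _
    qExpandable_E6.mdiff hY.mdiff]

lemma cast_mul_add_ne_zero (k m : ℕ) (hm : m ≠ 0) : (6 * k + m : ℂ) ≠ 0 := by
  have : 6 * k + m ≠ 0 := by omega
  exact_mod_cast this

/-! ### Differential equations of the extremal forms -/

/-- The first order system equivalent to the Kaneko–Zagier equation. -/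
lemma normalizedDeriv_ext (k : ℕ) :
    D (extY k) = ((6 * k - 1 : ℂ) / 12) • (E2 * extY k) + ((6 * k + 1 : ℂ) / 12) • extZ k ∧
    D (extZ k) = ((6 * k + 1 : ℂ) / 12) • (E2 * extZ k) +
      ((6 * k - 1 : ℂ) / 12) • (E₄ * extY k) := by
  induction k with
  | zero =>
    constructor
    · rw [extY_zero, extZ_zero]
      have h : D (1 : ℍ → ℂ) = 0 := Derivative.normalizedDerivOfComplex_const 1
      rw [h]
      ext z
      simp
      ring
    · rw [extY_zero, extZ_zero, ramanujan_E2]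
      ext z
      simp
      ring
  | succ k ih =>
    have hY := qExpandable_extY k
    have hZ := qExpandable_extZ k
    have h5 := cast_mul_add_ne_zero k 5 (by norm_num)
    have h7 := cast_mul_add_ne_zero k 7 (by norm_num)
    push_cast at h5 h7
    constructor
    · rw [extY_succ, extZ_succ, Derivative.normalizedDerivOfComplex_smul _ _
        ((qExpandable_E4.mul hZ).sub (qExpandable_E6.mul hY)).mdiff,
        normalizedDeriv_E4_mul_sub hY hZ, ramanujan_E4, ramanujan_E6, ih.1, ih.2]
      ext z
      simp
      field_simp
      ring
    · rw [extY_succ, extZ_succ, Derivative.normalizedDerivOfComplex_smul _ _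
        ((qExpandable_E4.mul (qExpandable_E4.mul hY)).sub (qExpandable_E6.mul hZ)).mdiff,
        normalizedDeriv_E4_mul_sub hZ (qExpandable_E4.mul hY),
        Derivative.normalizedDerivOfComplex_mul _ _ qExpandable_E4.mdiff hY.mdiff,
        ramanujan_E4, ramanujan_E6, ih.1, ih.2]
      ext z
      simp
      field_simp
      ring

lemma normalizedDeriv_E4_eq : D E₄ = (240 : ℂ) • extY 1 := by
  rw [ramanujan_E4, extY_succ, extY_zero, extZ_zero]
  ext z
  simp
  ring

lemma normalizedDeriv_E6_eq : D E₆ = (-504 : ℂ) • extZ 1 := by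
  rw [ramanujan_E6, extZ_succ, extY_zero, extZ_zero]
  ext z
  simp
  ring

/-- E2 and E₆ no longer appear outside the extremal forms, and all coefficients are positive; this
is what makes an induction on decay possible. -/
lemma normalizedDeriv_extY_succ (k : ℕ) : D (extY (k + 1)) =
    (6 * k + 6 : ℂ) • ((5 / 72 : ℂ) • (extY 1 * extZ k) + (7 / 72 : ℂ) • (extZ 1 * extY k)) := by
  have h5 := cast_mul_add_ne_zero k 5 (by norm_num)
  have h7 := cast_mul_add_ne_zero k 7 (by norm_num)
  push_cast at h5 h7
  rw [(normalizedDeriv_ext (k + 1)).1, extY_succ, extZ_succ, extY_succ 0, extZ_succ 0, extY_zero,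
    extZ_zero]
  ext z
  simp
  field_simp
  ring

lemma normalizedDeriv_extZ_succ (k : ℕ) : D (extZ (k + 1)) =
    (6 * k + 6 : ℂ) • ((5 / 72 : ℂ) • (extY 1 * (E₄ * extY k)) +
      (7 / 72 : ℂ) • (extZ 1 * extZ k)) := by
  have h5 := cast_mul_add_ne_zero k 5 (by norm_num)
  have h7 := cast_mul_add_ne_zero k 7 (by norm_num)
  push_cast at h5 h7
  rw [(normalizedDeriv_ext (k + 1)).2, extY_succ, extZ_succ, extY_succ 0, extZ_succ 0, extY_zero,
    extZ_zero]
  ext z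
  simp
  field_simp
  ring

/-- E₄Y_k enters the derivative of Z_{k+1}, so it must be carried through the induction as a third
family. -/
lemma normalizedDeriv_E4_mul_extY (k : ℕ) : D (E₄ * extY (k + 1)) =
    (240 : ℂ) • (extY 1 * extY (k + 1)) + (6 * k + 6 : ℂ) •
      ((5 / 72 : ℂ) • ((E₄ * extY 1) * extZ k) + (7 / 72 : ℂ) • (extZ 1 * (E₄ * extY k))) := by
  rw [Derivative.normalizedDerivOfComplex_mul _ _ qExpandable_E4.mdiff
    (qExpandable_extY (k + 1)).mdiff, normalizedDeriv_extY_succ, normalizedDeriv_E4_eq]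
  ext z
  simp
  ring

/-! ### Vanishing orders and leading coefficients -/

open PowerSeries in
lemma exists_eq_X_mul {p : PowerSeries ℂ} (h : p.coeff 0 = 0) :
    ∃ u : PowerSeries ℂ, p = X * u ∧ u.coeff 0 = p.coeff 1 := by
  obtain ⟨u, rfl⟩ := X_dvd_iff.mpr (by simpa using h)
  exact ⟨u, rfl, (PowerSeries.coeff_succ_X_mul 0 u).symm⟩

lemma coeff_one_mul (p r : PowerSeries ℂ) :
    (p * r).coeff 1 = p.coeff 0 * r.coeff 1 + p.coeff 1 * r.coeff 0 := by
  simp [PowerSeries.coeff_mul, Finset.Nat.antidiagonal_succ]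

lemma coeff_zero_mul (p r : PowerSeries ℂ) : (p * r).coeff 0 = p.coeff 0 * r.coeff 0 := by
  simp

open PowerSeries in
-- In E₄Z_k − E₆Y_k and E₄²Y_k − E₆Z_k the coefficients of q^k cancel. The next ones depend only on
-- the difference of the second coefficients of Z_k and Y_k, which the differential system
-- determines; they equal 864(6k+5)/(6k+6) and 864(6k+7)/(6k+6). The constants in the recursion are
-- the inverses.
lemma qExpansion_ext (k : ℕ) : ∃ u v : PowerSeries ℂ, qExpansion 1 (extY k) = X ^ k * u ∧
    qExpansion 1 (extZ k) = X ^ k * v ∧ u.coeff 0 = 1 ∧ v.coeff 0 = 1 := by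
  induction k with
  | zero =>
    refine ⟨1, qExpansion 1 E2, ?_, ?_, by simp, by simp [coeff_E2, -coeff_zero_eq_constantCoeff]⟩
    · rw [extY_zero, qExpansion_one, pow_zero, one_mul]
    · rw [extZ_zero, pow_zero, one_mul]
  | succ k ih =>
    obtain ⟨u, v, hu, hv, hu0, hv0⟩ := ih
    have hY := qExpandable_extY k
    have hZ := qExpandable_extZ k
    have hX : (X : PowerSeries ℂ) ^ k ≠ 0 := pow_ne_zero k X_ne_zero
    have h5 := cast_mul_add_ne_zero k 5 (by norm_num)
    have h6 := cast_mul_add_ne_zero k 6 (by norm_num)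
    have h7 := cast_mul_add_ne_zero k 7 (by norm_num)
    push_cast at h5 h6 h7
    have e1 : C (k : ℂ) * u + qDeriv u =
        ((6 * k - 1 : ℂ) / 12) • (qExpansion 1 E2 * u) + ((6 * k + 1 : ℂ) / 12) • v := by
      refine mul_left_cancel₀ hX ?_
      rw [← qDeriv_X_pow_mul, ← hu, ← hY.qExpansion_normalizedDeriv, (normalizedDeriv_ext k).1,
        ((qExpandable_E2.mul hY).smul _).qExpansion_add (hZ.smul _),
        (qExpandable_E2.mul hY).qExpansion_smul, hZ.qExpansion_smul,
        qExpandable_E2.qExpansion_mul hY, hu, hv, mul_add, mul_smul_comm, mul_smul_comm,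
        mul_left_comm]
    have e2 : C (k : ℂ) * v + qDeriv v = ((6 * k + 1 : ℂ) / 12) • (qExpansion 1 E2 * v) +
        ((6 * k - 1 : ℂ) / 12) • (qExpansion 1 E₄ * u) := by
      refine mul_left_cancel₀ hX ?_
      rw [← qDeriv_X_pow_mul, ← hv, ← hZ.qExpansion_normalizedDeriv, (normalizedDeriv_ext k).2,
        ((qExpandable_E2.mul hZ).smul _).qExpansion_add ((qExpandable_E4.mul hY).smul _),
        (qExpandable_E2.mul hZ).qExpansion_smul, (qExpandable_E4.mul hY).qExpansion_smul,
        qExpandable_E2.qExpansion_mul hZ, qExpandable_E4.qExpansion_mul hY, hu, hv, mul_add,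
        mul_smul_comm, mul_smul_comm, mul_left_comm, mul_left_comm (X ^ k) (qExpansion 1 E₄)]
    have s1 : ArithmeticFunction.sigma 1 1 = 1 := by simp
    have s3 : ArithmeticFunction.sigma 3 1 = 1 := by simp
    have s5 : ArithmeticFunction.sigma 5 1 = 1 := by simp
    -- The constant coefficients of `e1` and `e2` hold trivially; the linear ones determine v₁ − u₁.
    have f1 := congrArg (coeff 1) e1
    have f2 := congrArg (coeff 1) e2
    simp only [map_add, coeff_C_mul, coeff_qDeriv, PowerSeries.coeff_smul, coeff_one_mul, coeff_E2,
      coeff_E4, hu0, hv0, s1, s3, if_pos, one_ne_zero, if_false, Nat.cast_one, smul_eq_mul]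
      at f1 f2
    have hdiff : (6 * k + 6 : ℂ) * (v.coeff 1 - u.coeff 1) = 120 * (6 * k) - 144 := by
      linear_combination 6 * f2 - 6 * f1
    have g1 : qExpansion 1 (extY (k + 1)) = X ^ k * (((6 * k + 6 : ℂ) / (864 * (6 * k + 5))) •
        (qExpansion 1 E₄ * v - qExpansion 1 E₆ * u)) := by
      rw [extY_succ, ((qExpandable_E4.mul hZ).sub (qExpandable_E6.mul hY)).qExpansion_smul,
        (qExpandable_E4.mul hZ).qExpansion_sub (qExpandable_E6.mul hY),
        qExpandable_E4.qExpansion_mul hZ, qExpandable_E6.qExpansion_mul hY, hu, hv, mul_smul_comm]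
      congr 1
      ring
    have g2 : qExpansion 1 (extZ (k + 1)) = X ^ k * (((6 * k + 6 : ℂ) / (864 * (6 * k + 7))) •
        (qExpansion 1 E₄ * (qExpansion 1 E₄ * u) - qExpansion 1 E₆ * v)) := by
      have h44 := qExpandable_E4.mul (qExpandable_E4.mul hY)
      rw [extZ_succ, (h44.sub (qExpandable_E6.mul hZ)).qExpansion_smul,
        h44.qExpansion_sub (qExpandable_E6.mul hZ),
        qExpandable_E4.qExpansion_mul (qExpandable_E4.mul hY), qExpandable_E4.qExpansion_mul hY,
        qExpandable_E6.qExpansion_mul hZ, hu, hv, mul_smul_comm]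
      congr 1
      ring
    obtain ⟨u', hu', hu0'⟩ := exists_eq_X_mul (p := ((6 * k + 6 : ℂ) / (864 * (6 * k + 5))) •
        (qExpansion 1 E₄ * v - qExpansion 1 E₆ * u)) (by
      rw [PowerSeries.coeff_smul, map_sub, coeff_zero_mul, coeff_zero_mul, coeff_E4, coeff_E6, hu0,
        hv0]
      simp)
    obtain ⟨v', hv', hv0'⟩ := exists_eq_X_mul (p := ((6 * k + 6 : ℂ) / (864 * (6 * k + 7))) •
        (qExpansion 1 E₄ * (qExpansion 1 E₄ * u) - qExpansion 1 E₆ * v)) (by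
      rw [PowerSeries.coeff_smul, map_sub, coeff_zero_mul, coeff_zero_mul, coeff_zero_mul, coeff_E4,
        coeff_E6, hu0, hv0]
      simp)
    refine ⟨u', v', by rw [g1, hu', pow_succ, mul_assoc], by rw [g2, hv', pow_succ, mul_assoc],
      ?_, ?_⟩
    · rw [hu0', PowerSeries.coeff_smul, map_sub, coeff_one_mul, coeff_one_mul, coeff_E4, coeff_E4,
        coeff_E6, coeff_E6, hu0, hv0, s3, s5]
      simp only [if_pos, one_ne_zero, if_false, Nat.cast_one, smul_eq_mul]
      field_simp
      linear_combination hdiff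
    · rw [hv0', PowerSeries.coeff_smul, map_sub, coeff_one_mul, coeff_one_mul, coeff_one_mul,
        coeff_zero_mul, coeff_E4, coeff_E4, coeff_E6, coeff_E6, hu0, hv0, s3, s5]
      simp only [if_pos, one_ne_zero, if_false, Nat.cast_one, smul_eq_mul]
      field_simp
      linear_combination -hdiff

open PowerSeries in
lemma isNormalizedExtremal_of_eq_X_pow_mul {w : ℤ} {k : ℕ} {F : ℍ → ℂ} {u : PowerSeries ℂ}
    (hw : 0 ≤ w) (hk : w.toNat / 6 = k) (hF : IsDepthOne w F) (h : qExpansion 1 F = X ^ k * u)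
    (hu : u.coeff 0 = 1) :
    IsNormalizedExtremal w 1 F ∧ ∀ G : ℍ → ℂ, IsNormalizedExtremal w 1 G → G = F := by
  refine isNormalizedExtremal_of_leading hw hF (fun i hi ↦ ?_) ?_
  · rw [h, coeff_X_pow_mul', if_neg (by omega)]
  · rw [h, hk, coeff_X_pow_mul', if_pos le_rfl, Nat.sub_self, hu]

lemma isNormalizedExtremal_extY (k : ℕ) : IsNormalizedExtremal (6 * k) 1 (extY k) ∧
    ∀ G : ℍ → ℂ, IsNormalizedExtremal (6 * k) 1 G → G = extY k := by
  obtain ⟨u, v, hu, hv, hu0, hv0⟩ := qExpansion_ext k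
  exact isNormalizedExtremal_of_eq_X_pow_mul (by positivity) (by omega) (isDepthOne_ext k).1 hu hu0

lemma isNormalizedExtremal_extZ (k : ℕ) : IsNormalizedExtremal (6 * k + 2) 1 (extZ k) ∧
    ∀ G : ℍ → ℂ, IsNormalizedExtremal (6 * k + 2) 1 G → G = extZ k := by
  obtain ⟨u, v, hu, hv, hu0, hv0⟩ := qExpansion_ext k
  exact isNormalizedExtremal_of_eq_X_pow_mul (by positivity) (by omega) (isDepthOne_ext k).2 hv hv0

lemma isNormalizedExtremal_E4_mul_extY (k : ℕ) :
    IsNormalizedExtremal (6 * k + 4) 1 (E₄ * extY k) ∧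
    ∀ G : ℍ → ℂ, IsNormalizedExtremal (6 * k + 4) 1 G → G = E₄ * extY k := by
  obtain ⟨u, v, hu, hv, hu0, hv0⟩ := qExpansion_ext k
  have hd := (isDepthOne_ext k).1.mul_left isModularForm_E4
  rw [add_comm] at hd
  refine isNormalizedExtremal_of_eq_X_pow_mul (k := k) (u := qExpansion 1 E₄ * u) (by positivity)
    (by omega) hd ?_ ?_
  · rw [qExpandable_E4.qExpansion_mul (qExpandable_extY k), hu, mul_left_comm]
  · rw [coeff_zero_mul, hu0, coeff_E4, if_pos rfl, one_mul]

lemma coeff_zero_extY_succ (k : ℕ) : (qExpansion 1 (extY (k + 1))).coeff 0 = 0 := by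
  obtain ⟨u, v, hu, hv, hu0, hv0⟩ := qExpansion_ext (k + 1)
  simp [hu]

lemma coeff_zero_extZ_succ (k : ℕ) : (qExpansion 1 (extZ (k + 1))).coeff 0 = 0 := by
  obtain ⟨u, v, hu, hv, hu0, hv0⟩ := qExpansion_ext (k + 1)
  simp [hv]

/-! ### Restriction to the imaginary axis -/

/-- The real part of `F (i t)`. -/
noncomputable def axisRe (F : ℍ → ℂ) (t : ℝ) : ℝ := (onImagAxis F t).re

/-- `F` takes real values on the positive imaginary axis. -/
def RealOnAxis (F : ℍ → ℂ) : Prop := ∀ t : ℝ, 0 < t → (onImagAxis F t).im = 0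

lemma im_I_mul (t : ℝ) : (Complex.I * t).im = t := by simp

lemma coe_ofComplex_I_mul {t : ℝ} (ht : 0 < t) :
    ((ofComplex (Complex.I * t) : ℍ) : ℂ) = Complex.I * t :=
  ofComplex_apply_of_im_pos (by rwa [im_I_mul]) ▸ rfl

lemma qParam_I_mul (t : ℝ) :
    Periodic.qParam 1 (Complex.I * t) = (Real.exp (-(2 * Real.pi * t)) : ℝ) := by
  rw [Periodic.qParam, Complex.ofReal_exp]
  congr 1
  push_cast
  linear_combination (2 * Real.pi * t : ℂ) * Complex.I_mul_I

lemma axisRe_add (F G : ℍ → ℂ) (t : ℝ) : axisRe (F + G) t = axisRe F t + axisRe G t := by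
  simp [axisRe, onImagAxis]

lemma axisRe_smul (c : ℝ) (F : ℍ → ℂ) (t : ℝ) : axisRe ((c : ℂ) • F) t = c * axisRe F t := by
  simp [axisRe, onImagAxis]

lemma axisRe_mul {F G : ℍ → ℂ} (hF : RealOnAxis F) {t : ℝ} (ht : 0 < t) :
    axisRe (F * G) t = axisRe F t * axisRe G t := by
  have h := hF t ht
  simp only [axisRe, onImagAxis, Pi.mul_apply, Complex.mul_re] at h ⊢
  rw [h, zero_mul, sub_zero]

namespace RealOnAxis

variable {F G : ℍ → ℂ}

lemma sub (hF : RealOnAxis F) (hG : RealOnAxis G) : RealOnAxis (F - G) := fun t ht ↦ by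
  have h1 := hF t ht
  have h2 := hG t ht
  simp_all [onImagAxis]

lemma mul (hF : RealOnAxis F) (hG : RealOnAxis G) : RealOnAxis (F * G) := fun t ht ↦ by
  have h1 := hF t ht
  have h2 := hG t ht
  simp_all [onImagAxis]

lemma smul (c : ℝ) (hF : RealOnAxis F) : RealOnAxis ((c : ℂ) • F) := fun t ht ↦ by
  have h1 := hF t ht
  simp_all [onImagAxis]

end RealOnAxis

lemma QExpandable.hasSum_onImagAxis {F : ℍ → ℂ} (hF : QExpandable F) {a : ℕ → ℝ}
    (ha : ∀ m, (qExpansion 1 F).coeff m = a m) {t : ℝ} (ht : 0 < t) :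
    HasSum (fun m ↦ ((a m * Real.exp (-(2 * Real.pi * t)) ^ m : ℝ) : ℂ)) (onImagAxis F t) := by
  have h := hF.hasSum (ofComplex (Complex.I * t))
  rw [coe_ofComplex_I_mul ht, qParam_I_mul] at h
  simpa [ha, onImagAxis] using h

lemma QExpandable.hasSum_axisRe {F : ℍ → ℂ} (hF : QExpandable F) {a : ℕ → ℝ}
    (ha : ∀ m, (qExpansion 1 F).coeff m = a m) {t : ℝ} (ht : 0 < t) :
    HasSum (fun m ↦ a m * Real.exp (-(2 * Real.pi * t)) ^ m) (axisRe F t) := by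
  simpa only [Complex.ofReal_re, axisRe] using Complex.hasSum_re (hF.hasSum_onImagAxis ha ht)

lemma QExpandable.realOnAxis {F : ℍ → ℂ} (hF : QExpandable F) {a : ℕ → ℝ}
    (ha : ∀ m, (qExpansion 1 F).coeff m = a m) : RealOnAxis F := fun t ht ↦ by
  have h := Complex.hasSum_im (hF.hasSum_onImagAxis ha ht)
  simp only [Complex.ofReal_im] at h
  exact h.unique hasSum_zero

lemma hasDerivAt_axisRe {F : ℍ → ℂ} (hF : MDiff F) {t : ℝ} (ht : 0 < t) :
    HasDerivAt (axisRe F) (-(2 * Real.pi * axisRe (D F) t)) t := by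
  set z : ℍ := ofComplex (Complex.I * t)
  have hz : (z : ℂ) = Complex.I * t := coe_ofComplex_I_mul ht
  have h1 : HasDerivAt (F ∘ ofComplex) (2 * Real.pi * Complex.I * D F z) (Complex.I * t) := by
    have h2 := (mdifferentiableAt_iff.mp (hF z)).hasDerivAt
    have h3 : 2 * Real.pi * Complex.I * D F z = deriv (F ∘ ofComplex) z :=
      mul_inv_cancel_left₀ Complex.two_pi_I_ne_zero _
    rwa [h3, ← hz]
  have h3 : HasDerivAt (fun s : ℂ ↦ (F ∘ ofComplex) (Complex.I * s))
      (2 * Real.pi * Complex.I * D F z * (Complex.I * 1)) t :=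
    h1.comp (t : ℂ) ((hasDerivAt_id (t : ℂ)).const_mul Complex.I)
  convert! h3.real_of_complex using 1
  rw [show 2 * Real.pi * Complex.I * D F z * (Complex.I * 1) =
    ((-(2 * Real.pi) : ℝ) : ℂ) * D F z by
      push_cast
      linear_combination (2 * Real.pi * D F z) * Complex.I_mul_I, Complex.re_ofReal_mul]
  simp [axisRe, onImagAxis, z]

lemma QExpandable.tendsto_axisRe {F : ℍ → ℂ} (hF : QExpandable F) :
    Tendsto (axisRe F) atTop (𝓝 ((qExpansion 1 F).coeff 0).re) := by
  have h1 : Tendsto (fun t : ℝ ↦ ofComplex (Complex.I * t)) atTop atImInfty := by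
    rw [atImInfty, tendsto_comap_iff]
    refine tendsto_id.congr' ?_
    filter_upwards [eventually_gt_atTop 0] with t ht
    rw [comp_apply, ← coe_im, coe_ofComplex_I_mul ht, im_I_mul, id]
  exact (Complex.continuous_re.tendsto _).comp (hF.tendsto_atImInfty.comp h1)

lemma IsModularForm.onImagAxis_inv {k : ℤ} {F : ℍ → ℂ} (hF : IsModularForm k F) {t : ℝ}
    (ht : 0 < t) : onImagAxis F (1 / t) = (Complex.I * t) ^ k * onImagAxis F t := by
  set z : ℍ := ofComplex (Complex.I * t) with hzdef
  have hz : (z : ℂ) = Complex.I * t := coe_ofComplex_I_mul ht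
  have h := congrFun (hF.2 ModularGroup.S) z
  have hS : ModularGroup.S • z = ofComplex (Complex.I * (1 / t : ℝ)) := by
    ext
    rw [coe_ofComplex_I_mul (by positivity), modular_S_smul, coe_mk, hz]
    have : (t : ℂ) ≠ 0 := by exact_mod_cast ht.ne'
    push_cast
    field_simp
    simp
  rw [SL_slash_apply, hS, ModularGroup.denom_S, hz, zpow_neg] at h
  have hne : (Complex.I * t : ℂ) ^ k ≠ 0 := zpow_ne_zero _ (hz ▸ z.ne_zero)
  rw [onImagAxis, onImagAxis, ← hzdef, ← h]
  field_simp

lemma axisRe_E4_inv {t : ℝ} (ht : 0 < t) : axisRe E₄ (1 / t) = t ^ 4 * axisRe E₄ t := by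
  have h := isModularForm_E4.onImagAxis_inv ht
  rw [axisRe, h, axisRe, ← Complex.re_ofReal_mul]
  congr 2
  rw [show (4 : ℤ) = (4 : ℕ) from rfl, zpow_natCast, mul_pow, Complex.I_pow_four]
  simp

lemma axisRe_E6_inv {t : ℝ} (ht : 0 < t) : axisRe E₆ (1 / t) = -t ^ 6 * axisRe E₆ t := by
  have h := isModularForm_E6.onImagAxis_inv ht
  rw [axisRe, h, axisRe, ← Complex.re_ofReal_mul]
  congr 2
  rw [show (6 : ℤ) = (6 : ℕ) from rfl, zpow_natCast, mul_pow,
    show Complex.I ^ 6 = Complex.I ^ 4 * Complex.I ^ 2 by ring, Complex.I_pow_four, Complex.I_sq]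
  simp

lemma antitoneOn_of_hasDerivAt_nonpos {s : Set ℝ} (hs : Convex ℝ s) {f f' : ℝ → ℝ}
    (hf : ∀ x ∈ s, HasDerivAt f (f' x) x) (hf' : ∀ x ∈ s, f' x ≤ 0) : AntitoneOn f s :=
  antitoneOn_of_hasDerivWithinAt_nonpos hs (fun x hx ↦ (hf x hx).continuousAt.continuousWithinAt)
    (fun x hx ↦ (hf x (interior_subset hx)).hasDerivWithinAt)
    fun x hx ↦ hf' x (interior_subset hx)

lemma monotoneOn_of_hasDerivAt_nonneg {s : Set ℝ} (hs : Convex ℝ s) {f f' : ℝ → ℝ}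
    (hf : ∀ x ∈ s, HasDerivAt f (f' x) x) (hf' : ∀ x ∈ s, 0 ≤ f' x) : MonotoneOn f s :=
  monotoneOn_of_hasDerivWithinAt_nonneg hs (fun x hx ↦ (hf x hx).continuousAt.continuousWithinAt)
    (fun x hx ↦ (hf x (interior_subset hx)).hasDerivWithinAt)
    fun x hx ↦ hf' x (interior_subset hx)

/-- A function on `(0, ∞)` is antitone if it is so on `[1, ∞)` and its image under `s ↦ 1 / s` is
monotone there. -/
lemma antitoneOn_Ioi_of_inv {g m : ℝ → ℝ} (h1 : AntitoneOn g (Set.Ici 1))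
    (h2 : MonotoneOn m (Set.Ici 1)) (h : ∀ s : ℝ, 1 ≤ s → g (1 / s) = m s) :
    AntitoneOn g (Set.Ioi 0) := by
  have h3 : AntitoneOn g (Set.Ioc 0 1) := by
    intro a ha b hb hab
    have ha1 : 1 ≤ 1 / a := by rw [le_div_iff₀ ha.1]; linarith [ha.2]
    have hb1 : 1 ≤ 1 / b := by rw [le_div_iff₀ hb.1]; linarith [hb.2]
    have := h2 hb1 ha1 (one_div_le_one_div_of_le ha.1 hab)
    rwa [← h _ ha1, ← h _ hb1, one_div_one_div, one_div_one_div] at this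
  rw [← Set.Ioc_union_Ici_eq_Ioi one_pos]
  exact h3.union_right h1 ⟨⟨one_pos, le_rfl⟩, fun x hx ↦ hx.2⟩ ⟨Set.self_mem_Ici, fun x hx ↦ hx⟩

/-! ### The `q`-series of the forms of weights 6 and 8 on the imaginary axis -/

lemma coeff_extY_one (m : ℕ) : (qExpansion 1 (extY 1)).coeff m = ((m * sigma 3 m : ℝ) : ℂ) := by
  have h := qExpandable_E4.coeff_normalizedDeriv m
  rw [normalizedDeriv_E4_eq, (qExpandable_extY 1).qExpansion_smul, PowerSeries.coeff_smul,
    coeff_E4, smul_eq_mul] at h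
  rcases eq_or_ne m 0 with rfl | hm
  · simpa using h
  · rw [if_neg hm] at h
    push_cast
    linear_combination h / 240

lemma coeff_extZ_one (m : ℕ) : (qExpansion 1 (extZ 1)).coeff m = ((m * sigma 5 m : ℝ) : ℂ) := by
  have h := qExpandable_E6.coeff_normalizedDeriv m
  rw [normalizedDeriv_E6_eq, (qExpandable_extZ 1).qExpansion_smul, PowerSeries.coeff_smul,
    coeff_E6, smul_eq_mul] at h
  rcases eq_or_ne m 0 with rfl | hm
  · simpa using h
  · rw [if_neg hm] at h
    push_cast
    linear_combination -h / 504

lemma coeff_deriv_extY_one (m : ℕ) :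
    (qExpansion 1 (D (extY 1))).coeff m = ((m * (m * sigma 3 m) : ℝ) : ℂ) := by
  rw [(qExpandable_extY 1).coeff_normalizedDeriv, coeff_extY_one]
  push_cast
  ring

lemma coeff_deriv_extZ_one (m : ℕ) :
    (qExpansion 1 (D (extZ 1))).coeff m = ((m * (m * sigma 5 m) : ℝ) : ℂ) := by
  rw [(qExpandable_extZ 1).coeff_normalizedDeriv, coeff_extZ_one]
  push_cast
  ring

lemma coeff_E2_real (m : ℕ) :
    (qExpansion 1 E2).coeff m = ((if m = 0 then 1 else -24 * sigma 1 m : ℝ) : ℂ) := by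
  rw [coeff_E2]
  split_ifs <;> simp

lemma coeff_E4_real (m : ℕ) :
    (qExpansion 1 E₄).coeff m = ((if m = 0 then 1 else 240 * sigma 3 m : ℝ) : ℂ) := by
  rw [coeff_E4]
  split_ifs <;> simp

lemma coeff_E6_real (m : ℕ) :
    (qExpansion 1 E₆).coeff m = ((if m = 0 then 1 else -504 * sigma 5 m : ℝ) : ℂ) := by
  rw [coeff_E6]
  split_ifs <;> simp

lemma realOnAxis_E4 : RealOnAxis E₄ := qExpandable_E4.realOnAxis coeff_E4_real

lemma realOnAxis_E6 : RealOnAxis E₆ := qExpandable_E6.realOnAxis coeff_E6_real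

lemma realOnAxis_ext (k : ℕ) : RealOnAxis (extY k) ∧ RealOnAxis (extZ k) := by
  induction k with
  | zero => exact ⟨fun t _ ↦ by simp [extY_zero, onImagAxis],
      qExpandable_E2.realOnAxis coeff_E2_real⟩
  | succ k ih =>
    constructor
    · have h := ((realOnAxis_E4.mul ih.2).sub (realOnAxis_E6.mul ih.1)).smul
        ((6 * k + 6) / (864 * (6 * k + 5)))
      push_cast at h
      exact h
    · have h := ((realOnAxis_E4.mul (realOnAxis_E4.mul ih.1)).sub (realOnAxis_E6.mul ih.2)).smul
        ((6 * k + 6) / (864 * (6 * k + 7)))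
      push_cast at h
      exact h

variable {t : ℝ}

lemma hasDerivAt_axisRe_E4 (ht : 0 < t) :
    HasDerivAt (axisRe E₄) (-(480 * Real.pi * axisRe (extY 1) t)) t := by
  have h := hasDerivAt_axisRe qExpandable_E4.mdiff ht
  rw [normalizedDeriv_E4_eq, show (240 : ℂ) = ((240 : ℝ) : ℂ) by norm_num, axisRe_smul] at h
  convert! h using 1
  ring

lemma hasDerivAt_axisRe_E6 (ht : 0 < t) :
    HasDerivAt (axisRe E₆) (1008 * Real.pi * axisRe (extZ 1) t) t := by
  have h := hasDerivAt_axisRe qExpandable_E6.mdiff ht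
  rw [normalizedDeriv_E6_eq, show (-504 : ℂ) = ((-504 : ℝ) : ℂ) by norm_num, axisRe_smul] at h
  convert! h using 1
  ring

lemma exp_le_axisRe_extY_one (ht : 0 < t) :
    Real.exp (-(2 * Real.pi * t)) ≤ axisRe (extY 1) t := by
  have h := (qExpandable_extY 1).hasSum_axisRe coeff_extY_one ht
  have h1 := le_hasSum h 1 fun m _ ↦ by positivity
  simpa using h1

lemma axisRe_extY_one_le (ht : 0 < t) : axisRe (extY 1) t ≤ axisRe (D (extY 1)) t := by
  refine hasSum_le (fun m ↦ ?_) ((qExpandable_extY 1).hasSum_axisRe coeff_extY_one ht)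
    ((qExpandable_extY 1).normalizedDeriv.hasSum_axisRe coeff_deriv_extY_one ht)
  rcases Nat.eq_zero_or_pos m with rfl | hm
  · simp
  · have h1 : (1 : ℝ) ≤ m := by exact_mod_cast hm
    gcongr
    exact le_mul_of_one_le_left (by positivity) h1

lemma axisRe_E4_le (ht : 0 < t) : axisRe E₄ t ≤ 1 + 240 * axisRe (extY 1) t := by
  have h1 := qExpandable_E4.hasSum_axisRe coeff_E4_real ht
  have h2 := ((qExpandable_extY 1).hasSum_axisRe coeff_extY_one ht).mul_left 240
  refine hasSum_le (fun m ↦ ?_) h1 ((hasSum_ite_eq 0 (1 : ℝ)).add h2)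
  rcases Nat.eq_zero_or_pos m with rfl | hm
  · simp
  · have h3 : (1 : ℝ) ≤ m := by exact_mod_cast hm
    rw [if_neg hm.ne', if_neg hm.ne', zero_add, mul_assoc, mul_assoc]
    gcongr
    exact le_mul_of_one_le_left (by positivity) h3

lemma one_le_axisRe_E4 (ht : 0 < t) : 1 ≤ axisRe E₄ t := by
  have h := le_hasSum (qExpandable_E4.hasSum_axisRe coeff_E4_real ht) 0 fun m hm ↦ by
    rw [if_neg hm]
    positivity
  simpa using h

lemma axisRe_extZ_one_nonneg (ht : 0 < t) : 0 ≤ axisRe (extZ 1) t :=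
  ((qExpandable_extZ 1).hasSum_axisRe coeff_extZ_one ht).nonneg fun m ↦ by positivity

lemma axisRe_extZ_one_le (ht : 0 < t) : axisRe (extZ 1) t ≤ axisRe (D (extZ 1)) t := by
  refine hasSum_le (fun m ↦ ?_) ((qExpandable_extZ 1).hasSum_axisRe coeff_extZ_one ht)
    ((qExpandable_extZ 1).normalizedDeriv.hasSum_axisRe coeff_deriv_extZ_one ht)
  rcases Nat.eq_zero_or_pos m with rfl | hm
  · simp
  · have h1 : (1 : ℝ) ≤ m := by exact_mod_cast hm
    gcongr
    exact le_mul_of_one_le_left (by positivity) h1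

lemma hasDerivAt_one_div (ht : 0 < t) : HasDerivAt (fun s : ℝ ↦ 1 / s) (-(1 / t ^ 2)) t := by
  simpa using hasDerivAt_inv ht.ne'

/-- The transformation of the weight 6 form under `t ↦ 1 / t`. -/
lemma axisRe_extY_one_inv (ht : 0 < t) : (1 / t) ^ 5 * (480 * Real.pi * axisRe (extY 1) (1 / t)) =
    4 * axisRe E₄ t - 480 * Real.pi * t * axisRe (extY 1) t := by
  -- The law is the derivative of E₄(i/t) = t⁴E₄(it), computed on both sides.
  have h1 := (hasDerivAt_axisRe_E4 (one_div_pos.mpr ht)).comp t (hasDerivAt_one_div ht)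
  have h2 := ((hasDerivAt_pow 4 t).mul (hasDerivAt_axisRe_E4 ht))
  have he : axisRe E₄ ∘ (fun s ↦ 1 / s) =ᶠ[𝓝 t] (fun s ↦ s ^ 4) * axisRe E₄ := by
    filter_upwards [lt_mem_nhds ht] with s hs
    exact axisRe_E4_inv hs
  have h3 := h1.unique (h2.congr_of_eventuallyEq he)
  simp only [Nat.cast_ofNat, Nat.add_one_sub_one] at h3
  field_simp at h3 ⊢
  linear_combination h3

/-- The transformation of the weight 8 form under `t ↦ 1 / t`. -/
lemma axisRe_extZ_one_inv (ht : 0 < t) : (1 / t) ^ 7 * (1008 * Real.pi * axisRe (extZ 1) (1 / t)) =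
    6 * axisRe E₆ t + 1008 * Real.pi * t * axisRe (extZ 1) t := by
  have h1 := (hasDerivAt_axisRe_E6 (one_div_pos.mpr ht)).comp t (hasDerivAt_one_div ht)
  have h2 := ((hasDerivAt_pow 6 t).neg.mul (hasDerivAt_axisRe_E6 ht))
  have he : axisRe E₆ ∘ (fun s ↦ 1 / s) =ᶠ[𝓝 t] (-fun s ↦ s ^ 6) * axisRe E₆ := by
    filter_upwards [lt_mem_nhds ht] with s hs
    exact axisRe_E6_inv hs
  have h3 := h1.unique (h2.congr_of_eventuallyEq he)
  simp only [Nat.cast_ofNat, Nat.add_one_sub_one, Pi.neg_apply] at h3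
  field_simp at h3 ⊢
  linear_combination -h3

/-! ### Weight 6 -/

/-- Here D Y₁ ≥ Y₁ coefficientwise, and 2πt ≥ 2π > 5. -/
lemma five_mul_axisRe_extY_one_le (ht : 1 ≤ t) :
    5 * axisRe (extY 1) t ≤ 2 * Real.pi * t * axisRe (D (extY 1)) t := by
  have ht0 : 0 < t := by linarith
  have h1 := axisRe_extY_one_le ht0
  have h2 := (Real.exp_pos _).le.trans (exp_le_axisRe_extY_one ht0)
  have h3 : 5 ≤ 2 * Real.pi * t := by nlinarith [Real.pi_gt_three]
  exact mul_le_mul h3 h1 h2 (by linarith)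

lemma hasDerivAt_axisRe_extY (k : ℕ) (ht : 0 < t) :
    HasDerivAt (axisRe (extY k)) (-(2 * Real.pi * axisRe (D (extY k)) t)) t :=
  hasDerivAt_axisRe (qExpandable_extY k).mdiff ht

lemma hasDerivAt_axisRe_extZ (k : ℕ) (ht : 0 < t) :
    HasDerivAt (axisRe (extZ k)) (-(2 * Real.pi * axisRe (D (extZ k)) t)) t :=
  hasDerivAt_axisRe (qExpandable_extZ k).mdiff ht

/-- This is the (0, 1] half of weight 6 after inversion. Its derivative is governed by the same
inequality 5Y₁ ≤ 2πt·DY₁ as the half on [1, ∞). -/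
lemma monotoneOn_four_mul_axisRe_E4_sub : MonotoneOn
    (fun t ↦ 4 * axisRe E₄ t - 480 * Real.pi * t * axisRe (extY 1) t) (Set.Ici 1) := by
  refine monotoneOn_of_hasDerivAt_nonneg (convex_Ici 1) (f' := fun t ↦
    480 * Real.pi * (2 * Real.pi * t * axisRe (D (extY 1)) t - 5 * axisRe (extY 1) t))
    (fun t ht ↦ ?_) fun t ht ↦ ?_
  · have ht0 : 0 < t := one_pos.trans_le ht
    convert! ((hasDerivAt_axisRe_E4 ht0).const_mul 4).sub (((hasDerivAt_id t).const_mul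
      (480 * Real.pi)).mul (hasDerivAt_axisRe_extY 1 ht0)) using 1
    simp only [id]
    ring
  · have := five_mul_axisRe_extY_one_le ht
    have := Real.pi_pos
    exact mul_nonneg (by positivity) (by linarith)

lemma antitoneOn_axisRe_extY_one :
    AntitoneOn (fun t ↦ t ^ 5 * axisRe (extY 1) t) (Set.Ioi 0) := by
  have h1 : AntitoneOn (fun t ↦ t ^ 5 * axisRe (extY 1) t) (Set.Ici 1) := by
    refine antitoneOn_of_hasDerivAt_nonpos (convex_Ici 1) (f' := fun t ↦
      t ^ 4 * (5 * axisRe (extY 1) t - 2 * Real.pi * t * axisRe (D (extY 1)) t))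
      (fun t ht ↦ ?_) fun t ht ↦ ?_
    · convert! (hasDerivAt_pow 5 t).mul (hasDerivAt_axisRe_extY 1 (one_pos.trans_le ht)) using 1
      simp
      ring
    · have := five_mul_axisRe_extY_one_le ht
      exact mul_nonpos_of_nonneg_of_nonpos (by positivity) (by linarith)
  refine antitoneOn_Ioi_of_inv h1 (m := fun t ↦ (480 * Real.pi)⁻¹ *
    (4 * axisRe E₄ t - 480 * Real.pi * t * axisRe (extY 1) t)) ?_ fun s hs ↦ ?_
  · intro a ha b hb hab
    have := Real.pi_pos
    exact mul_le_mul_of_nonneg_left (monotoneOn_four_mul_axisRe_E4_sub ha hb hab) (by positivity)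
  · rw [← axisRe_extY_one_inv (one_pos.trans_le hs)]
    have := Real.pi_pos
    field_simp

/-! ### Weight 10 -/

/-- At the fixed point t = 1 the inversion law of Y₁ forces equality, and the difference of the two
sides is monotone from there on. -/
lemma two_mul_axisRe_E4_ge (ht : 1 ≤ t) :
    480 * Real.pi * t * axisRe (extY 1) t ≤ 2 * axisRe E₄ t := by
  have hmono : MonotoneOn
      (fun t ↦ 2 * axisRe E₄ t - 480 * Real.pi * t * axisRe (extY 1) t) (Set.Ici 1) := by
    refine monotoneOn_of_hasDerivAt_nonneg (convex_Ici 1) (f' := fun t ↦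
      480 * Real.pi * (2 * Real.pi * t * axisRe (D (extY 1)) t - 3 * axisRe (extY 1) t))
      (fun t ht ↦ ?_) fun t ht ↦ ?_
    · have ht0 : 0 < t := one_pos.trans_le ht
      convert! ((hasDerivAt_axisRe_E4 ht0).const_mul 2).sub (((hasDerivAt_id t).const_mul
        (480 * Real.pi)).mul (hasDerivAt_axisRe_extY 1 ht0)) using 1
      simp only [id]
      ring
    · have := five_mul_axisRe_extY_one_le ht
      have := (Real.exp_pos _).le.trans (exp_le_axisRe_extY_one (one_pos.trans_le ht))
      have := Real.pi_pos
      exact mul_nonneg (by positivity) (by linarith)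
  have h1 := hmono Set.self_mem_Ici ht ht
  have h2 := axisRe_extY_one_inv one_pos
  norm_num at h1 h2
  linarith

/-- With x = 8 − y and 0 ≤ y ≤ 1.72, the bounds e⁸ ≤ 3000 and the cubic Taylor polynomial of e^y
turn this into a polynomial inequality. -/
lemma eight_sub_le_of_two_pi_le {x : ℝ} (hx : 2 * Real.pi ≤ x) (hx8 : x ≤ 8) :
    8 - x ≤ 240 * (2 * x - 8) * Real.exp (-x) := by
  have hpi := Real.pi_gt_d2
  obtain ⟨y, rfl⟩ : ∃ y, x = 8 - y := ⟨8 - x, by ring⟩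
  have hy : 0 ≤ y := by linarith
  have hy2 : y ≤ 1.72 := by linarith
  have h8 : (1 / 3000 : ℝ) ≤ Real.exp (-8) := by
    have h1 : Real.exp 8 ≤ 3000 := by
      rw [show (8 : ℝ) = (8 : ℕ) * 1 by norm_num, Real.exp_nat_mul]
      calc Real.exp 1 ^ 8 ≤ 2.7183 ^ 8 := by
            gcongr
            linarith [Real.exp_one_lt_d9]
        _ ≤ 3000 := by norm_num
    rw [Real.exp_neg, ← one_div]
    exact one_div_le_one_div_of_le (Real.exp_pos _) h1
  have hey : 1 + y + y ^ 2 / 2 + y ^ 3 / 6 ≤ Real.exp y := by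
    have h := Real.sum_le_exp_of_nonneg hy 4
    simp [Finset.sum_range_succ, Nat.factorial] at h
    linarith
  have h1 : Real.exp (-(8 - y)) = Real.exp (-8) * Real.exp y := by
    rw [← Real.exp_add]
    ring_nf
  rw [h1]
  have h2 : 1 / 3000 * (1 + y + y ^ 2 / 2 + y ^ 3 / 6) ≤ Real.exp (-8) * Real.exp y := by
    gcongr
  have h3 : y ≤ 240 * (2 * (8 - y) - 8) * (1 / 3000 * (1 + y + y ^ 2 / 2 + y ^ 3 / 6)) := by
    nlinarith [mul_nonneg hy hy, mul_nonneg (mul_nonneg hy hy) hy, sq_nonneg (y - 3 / 2),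
      mul_nonneg hy (sq_nonneg (y - 3 / 2)), mul_nonneg (pow_nonneg hy 3) (sub_nonneg.mpr hy2)]
  have h4 : 0 ≤ 240 * (2 * (8 - y) - 8) := by linarith
  have := mul_le_mul_of_nonneg_left h2 h4
  linarith

/-- Put x = 2πt. For x ≥ 8 the left side is not positive. Otherwise E₄ ≤ 1 + 240Y₁ reduces the claim
to 8 − x ≤ 240(2x − 8)Y₁, and Y₁ ≥ e^(−x). -/
lemma eight_sub_mul_axisRe_E4_le (ht : 1 ≤ t) :
    (8 - 2 * Real.pi * t) * axisRe E₄ t ≤ 480 * Real.pi * t * axisRe (extY 1) t := by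
  have ht0 : 0 < t := by linarith
  have hpi := Real.pi_gt_d2
  have hx : 2 * Real.pi ≤ 2 * Real.pi * t := by nlinarith
  have hX := exp_le_axisRe_extY_one ht0
  have hE := one_le_axisRe_E4 ht0
  have hX0 := (Real.exp_pos _).le.trans hX
  rcases le_total (2 * Real.pi * t) 8 with h8 | h8
  · have h1 := eight_sub_le_of_two_pi_le hx h8
    have h2 := mul_le_mul_of_nonneg_left (axisRe_E4_le ht0) (sub_nonneg.mpr h8)
    have h3 : 240 * (2 * (2 * Real.pi * t) - 8) * Real.exp (-(2 * Real.pi * t)) ≤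
        240 * (2 * (2 * Real.pi * t) - 8) * axisRe (extY 1) t := by
      gcongr
      linarith
    linarith
  · refine le_trans (mul_nonpos_of_nonpos_of_nonneg (by linarith) (by linarith)) ?_
    positivity

lemma eight_mul_axisRe_E4_mul_le (ht : 1 ≤ t) :
    8 * (axisRe E₄ t * axisRe (extY 1) t) ≤ 2 * Real.pi * t * (axisRe E₄ t * axisRe (D (extY 1)) t) +
      480 * Real.pi * t * axisRe (extY 1) t ^ 2 := by
  have ht0 : 0 < t := by linarith
  have hX0 := (Real.exp_pos _).le.trans (exp_le_axisRe_extY_one ht0)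
  have hE := one_le_axisRe_E4 ht0
  have h1 := mul_le_mul_of_nonneg_right (eight_sub_mul_axisRe_E4_le ht) hX0
  have h2 : 2 * Real.pi * t * (axisRe E₄ t * axisRe (extY 1) t) ≤
      2 * Real.pi * t * (axisRe E₄ t * axisRe (D (extY 1)) t) := by
    have := Real.pi_pos
    gcongr
    exact axisRe_extY_one_le ht0
  linarith

lemma antitoneOn_axisRe_E4_mul_extY_one :
    AntitoneOn (fun t ↦ t ^ 8 * axisRe (E₄ * extY 1) t) (Set.Ioi 0) := by
  have hmul : ∀ t ∈ Set.Ioi (0 : ℝ), t ^ 8 * (axisRe E₄ t * axisRe (extY 1) t) =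
      t ^ 8 * axisRe (E₄ * extY 1) t := fun t ht ↦ by rw [axisRe_mul realOnAxis_E4 ht]
  refine AntitoneOn.congr ?_ hmul
  have h1 : AntitoneOn (fun t ↦ t ^ 8 * (axisRe E₄ t * axisRe (extY 1) t)) (Set.Ici 1) := by
    refine antitoneOn_of_hasDerivAt_nonpos (convex_Ici 1) (f' := fun t ↦
      t ^ 7 * (8 * (axisRe E₄ t * axisRe (extY 1) t) -
        (2 * Real.pi * t * (axisRe E₄ t * axisRe (D (extY 1)) t) +
          480 * Real.pi * t * axisRe (extY 1) t ^ 2))) (fun t ht ↦ ?_) fun t ht ↦ ?_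
    · have ht0 : 0 < t := one_pos.trans_le ht
      convert! (hasDerivAt_pow 8 t).mul
        ((hasDerivAt_axisRe_E4 ht0).mul (hasDerivAt_axisRe_extY 1 ht0)) using 1
      simp
      ring
    · exact mul_nonpos_of_nonneg_of_nonpos (pow_nonneg (zero_le_one.trans ht) 7)
        (sub_nonpos.mpr (eight_mul_axisRe_E4_mul_le ht))
  have h2 : MonotoneOn (fun t ↦ t * axisRe E₄ t *
      (4 * axisRe E₄ t - 480 * Real.pi * t * axisRe (extY 1) t)) (Set.Ici 1) := by
    -- The derivative is split so that the first summand is controlled by `two_mul_axisRe_E4_ge` and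
    -- the second by the inequality already used on [1, ∞).
    refine monotoneOn_of_hasDerivAt_nonneg (convex_Ici 1) (f' := fun t ↦
      2 * axisRe E₄ t * (2 * axisRe E₄ t - 480 * Real.pi * t * axisRe (extY 1) t) +
      t * (480 * Real.pi) * ((2 * Real.pi * t * (axisRe E₄ t * axisRe (D (extY 1)) t) +
        480 * Real.pi * t * axisRe (extY 1) t ^ 2) - 8 * (axisRe E₄ t * axisRe (extY 1) t)))
      (fun t ht ↦ ?_) fun t ht ↦ ?_
    · have ht0 : 0 < t := one_pos.trans_le ht
      convert! ((hasDerivAt_id t).mul (hasDerivAt_axisRe_E4 ht0)).mul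
        (((hasDerivAt_axisRe_E4 ht0).const_mul 4).sub (((hasDerivAt_id t).const_mul
        (480 * Real.pi)).mul (hasDerivAt_axisRe_extY 1 ht0))) using 1
      simp
      ring
    · have ht0 : 0 < t := one_pos.trans_le ht
      have h3 := two_mul_axisRe_E4_ge ht
      have h4 := eight_mul_axisRe_E4_mul_le ht
      have h5 := one_le_axisRe_E4 ht0
      have := Real.pi_pos
      exact add_nonneg (mul_nonneg (by linarith) (by linarith))
        (mul_nonneg (by positivity) (by linarith))
  refine antitoneOn_Ioi_of_inv h1 (m := fun t ↦ (480 * Real.pi)⁻¹ * (t * axisRe E₄ t *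
    (4 * axisRe E₄ t - 480 * Real.pi * t * axisRe (extY 1) t))) ?_ fun s hs ↦ ?_
  · intro a ha b hb hab
    have := Real.pi_pos
    exact mul_le_mul_of_nonneg_left (h2 ha hb hab) (by positivity)
  · have hs0 : 0 < s := one_pos.trans_le hs
    rw [← axisRe_extY_one_inv hs0, axisRe_E4_inv hs0]
    have := Real.pi_pos
    field_simp

/-! ### Weight 8 -/

lemma six_mul_axisRe_extZ_one_le (ht : 1 ≤ t) :
    6 * axisRe (extZ 1) t ≤ 2 * Real.pi * t * axisRe (D (extZ 1)) t := by
  have ht0 : 0 < t := by linarith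
  have h3 : 6 ≤ 2 * Real.pi * t := by nlinarith [Real.pi_gt_three]
  exact mul_le_mul h3 (axisRe_extZ_one_le ht0) (axisRe_extZ_one_nonneg ht0) (by linarith)

/-- The m-th coefficient of the right side is 1008·σ₅(m)(πtm − 3) ≥ 0 for m ≥ 1, and the constant
term is 6. -/
lemma six_le_six_mul_axisRe_E6_add (ht : 1 ≤ t) :
    6 ≤ 6 * axisRe E₆ t + 1008 * Real.pi * t * axisRe (extZ 1) t := by
  have ht0 : 0 < t := by linarith
  have h1 := (qExpandable_E6.hasSum_axisRe coeff_E6_real ht0).mul_left 6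
  have h2 := ((qExpandable_extZ 1).hasSum_axisRe coeff_extZ_one ht0).mul_left (1008 * Real.pi * t)
  refine hasSum_le (fun m ↦ ?_) (hasSum_ite_eq 0 (6 : ℝ)) (h1.add h2)
  rcases Nat.eq_zero_or_pos m with rfl | hm
  · simp
  · have h3 : (1 : ℝ) ≤ m := by exact_mod_cast hm
    have h4 : 3 ≤ Real.pi * (t * m) := by
      nlinarith [Real.pi_gt_three, mul_le_mul ht h3 zero_le_one ht0.le]
    rw [if_neg hm.ne', if_neg hm.ne']
    have h5 : 0 ≤ (sigma 5 m : ℝ) * Real.exp (-(2 * Real.pi * t)) ^ m := by positivity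
    have := mul_nonneg (sub_nonneg.mpr h4) h5
    linarith

/-- The function `(x ^ 2 - 7 x) e ^ (-x)` that governs the monotonicity in weight 8. -/
noncomputable def octicKernel (x : ℝ) : ℝ := (x ^ 2 - 7 * x) * Real.exp (-x)

lemma hasDerivAt_octicKernel (x : ℝ) :
    HasDerivAt octicKernel (-(x ^ 2 - 9 * x + 7) * Real.exp (-x)) x := by
  have h := ((hasDerivAt_pow 2 x).sub ((hasDerivAt_id x).const_mul 7)).mul
    (hasDerivAt_neg x).exp
  convert! h using 1
  simp
  ring

lemma antitoneOn_octicKernel : AntitoneOn octicKernel (Set.Ici 9) := by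
  refine antitoneOn_of_hasDerivAt_nonpos (convex_Ici 9) (fun x _ ↦ hasDerivAt_octicKernel x)
    fun x hx ↦ ?_
  have hx' : 9 ≤ x := hx
  exact mul_nonpos_of_nonpos_of_nonneg (by nlinarith) (Real.exp_pos _).le

lemma octicKernel_le (x : ℝ) (hx : 6 ≤ x) : octicKernel x ≤ 3 / 1000 := by
  rcases le_total x 7 with h7 | h7
  · have : octicKernel x ≤ 0 :=
      mul_nonpos_of_nonpos_of_nonneg (by nlinarith) (Real.exp_pos _).le
    linarith
  -- Beyond 7 the kernel peaks at about 0.0027 near x = 8.14, so a cubic Taylor bound for e^x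
  -- centred at 7 is sharp enough.
  · have h1 : 1096 * (1 + (x - 7) + (x - 7) ^ 2 / 2 + (x - 7) ^ 3 / 6) ≤ Real.exp x := by
      have h2 : (1096 : ℝ) ≤ Real.exp 7 := by
        rw [show (7 : ℝ) = (7 : ℕ) * 1 by norm_num, Real.exp_nat_mul]
        calc (1096 : ℝ) ≤ 2.7182 ^ 7 := by norm_num
          _ ≤ Real.exp 1 ^ 7 := by
            gcongr
            linarith [Real.exp_one_gt_d9]
      have h3 : 1 + (x - 7) + (x - 7) ^ 2 / 2 + (x - 7) ^ 3 / 6 ≤ Real.exp (x - 7) := by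
        have h := Real.sum_le_exp_of_nonneg (sub_nonneg.mpr h7) 4
        simp [Finset.sum_range_succ, Nat.factorial] at h
        linarith
      calc _ ≤ Real.exp 7 * Real.exp (x - 7) := by
            have : 0 ≤ x - 7 := by linarith
            gcongr
        _ = Real.exp x := by rw [← Real.exp_add]; ring_nf
    rw [octicKernel, Real.exp_neg, ← div_eq_mul_inv, div_le_iff₀ (Real.exp_pos _)]
    obtain ⟨y, rfl⟩ : ∃ y, x = 7 + y := ⟨x - 7, by ring⟩
    have hy : 0 ≤ y := by linarith
    rw [add_sub_cancel_left] at h1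
    nlinarith [mul_nonneg hy (sq_nonneg (y - 1)), sq_nonneg (y - 1), pow_nonneg hy 3]

lemma neg_octicKernel_two_pi_le : -octicKernel (2 * Real.pi) ≤ 88 / 10000 := by
  have h1 := Real.pi_gt_d4
  have h2 := Real.pi_lt_d4
  have h3 : (520 : ℝ) ≤ Real.exp (2 * Real.pi) := by
    have h4 : (403 : ℝ) ≤ Real.exp 6 := by
      rw [show (6 : ℝ) = (6 : ℕ) * 1 by norm_num, Real.exp_nat_mul]
      calc (403 : ℝ) ≤ 2.7182 ^ 6 := by norm_num
        _ ≤ Real.exp 1 ^ 6 := by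
          gcongr
          linarith [Real.exp_one_gt_d9]
    have h5 : (1.3 : ℝ) ≤ Real.exp (2 * Real.pi - 6) := by
      have h := Real.sum_le_exp_of_nonneg (x := 2 * Real.pi - 6) (by linarith) 3
      simp [Finset.sum_range_succ, Nat.factorial] at h
      nlinarith
    calc (520 : ℝ) ≤ 403 * 1.3 := by norm_num
      _ ≤ Real.exp 6 * Real.exp (2 * Real.pi - 6) := by gcongr
      _ = Real.exp (2 * Real.pi) := by rw [← Real.exp_add]; ring_nf
  rw [octicKernel, Real.exp_neg, ← neg_mul, ← div_eq_mul_inv, div_le_iff₀ (Real.exp_pos _)]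
  nlinarith

lemma hasSum_octicKernel (ht : 0 < t) :
    HasSum (fun m : ℕ ↦ (sigma 5 m : ℝ) * octicKernel (2 * Real.pi * t * m))
      (2 * Real.pi * t * (2 * Real.pi * t * axisRe (D (extZ 1)) t - 7 * axisRe (extZ 1) t)) := by
  have h1 := ((qExpandable_extZ 1).normalizedDeriv.hasSum_axisRe coeff_deriv_extZ_one
    ht).mul_left (2 * Real.pi * t)
  have h2 := ((qExpandable_extZ 1).hasSum_axisRe coeff_extZ_one ht).mul_left 7
  refine ((h1.sub h2).mul_left (2 * Real.pi * t)).congr_fun fun m ↦ ?_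
  rw [octicKernel, ← Real.exp_nat_mul, show (m : ℝ) * -(2 * Real.pi * t) = -(2 * Real.pi * t * m) by
    ring]
  ring

/-- Differentiate the inversion law of Z₁ at its fixed point t = 1; the E₆ terms cancel. -/
lemma two_pi_mul_axisRe_deriv_extZ_one :
    2 * Real.pi * axisRe (D (extZ 1)) 1 = 7 * axisRe (extZ 1) 1 := by
  have h1 := ((hasDerivAt_axisRe_E6 one_pos).const_mul 6).add (((hasDerivAt_id (1 : ℝ)).const_mul
    (1008 * Real.pi)).mul (hasDerivAt_axisRe_extZ 1 one_pos))
  have h2 := ((hasDerivAt_pow 7 (1 / 1 : ℝ)).mul ((hasDerivAt_axisRe_extZ 1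
    (t := 1 / 1) (by norm_num)).const_mul (1008 * Real.pi))).comp 1 (hasDerivAt_one_div one_pos)
  have he : ((fun s : ℝ ↦ s ^ 7) * fun s ↦ 1008 * Real.pi * axisRe (extZ 1) s) ∘ (fun s ↦ 1 / s)
      =ᶠ[𝓝 1] (fun s ↦ 6 * axisRe E₆ s) + ((fun s ↦ 1008 * Real.pi * id s) * axisRe (extZ 1)) := by
    filter_upwards [lt_mem_nhds (one_pos : (0 : ℝ) < 1)] with s hs
    exact axisRe_extZ_one_inv hs
  have h3 := h2.unique (h1.congr_of_eventuallyEq he)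
  have hpi := Real.pi_pos
  simp only [Nat.cast_ofNat, Nat.add_one_sub_one, id, one_pow, div_one, mul_one, one_mul] at h3
  have h4 : Real.pi * (2 * Real.pi * axisRe (D (extZ 1)) 1 - 7 * axisRe (extZ 1) 1) = 0 := by
    linear_combination h3 / 2016
  rcases mul_eq_zero.mp h4 with h | h <;> linarith

/-- The left side is S(t) = Σ σ₅(m)K(2πtm) with K = `octicKernel`, and S(1) = 0. The terms with m ≥
2 only decrease from t = 1, since their arguments lie where K is antitone. Hence S(t) ≤ K(2πt) −
K(2π) ≤ 0.003 + 0.0088. -/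
lemma octic_sum_le (ht : 1 ≤ t) :
    2 * Real.pi * t * (2 * Real.pi * t * axisRe (D (extZ 1)) t - 7 * axisRe (extZ 1) t) ≤
      118 / 10000 := by
  have ht0 : 0 < t := by linarith
  have h1 := hasSum_octicKernel ht0
  have h2 := hasSum_octicKernel one_pos
  have h0 : 2 * Real.pi * 1 * (2 * Real.pi * 1 * axisRe (D (extZ 1)) 1 - 7 * axisRe (extZ 1) 1) =
      0 := by
    rw [mul_one, two_pi_mul_axisRe_deriv_extZ_one, sub_self, mul_zero]
  rw [h0] at h2
  have h3 := h1.sub (hasSum_ite_eq 1 (octicKernel (2 * Real.pi * t)))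
  have h4 := h2.sub (hasSum_ite_eq 1 (octicKernel (2 * Real.pi)))
  have h5 := hasSum_le (fun m ↦ ?_) h3 h4
  · have h6 := octicKernel_le (2 * Real.pi * t) (by nlinarith [Real.pi_gt_three])
    have h7 := neg_octicKernel_two_pi_le
    linarith
  · rcases Nat.lt_or_ge m 2 with hm | hm
    · interval_cases m <;> simp
    · rw [if_neg (by omega), if_neg (by omega), sub_zero, sub_zero]
      have hm' : (2 : ℝ) ≤ m := by exact_mod_cast hm
      have hpi := Real.pi_gt_three
      have h6 : 9 ≤ 2 * Real.pi * 1 * m := by nlinarith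
      have h7 : 2 * Real.pi * 1 * m ≤ 2 * Real.pi * t * m := by gcongr
      exact mul_le_mul_of_nonneg_left (antitoneOn_octicKernel h6 (h6.trans h7) h7) (by positivity)

lemma antitoneOn_axisRe_extZ_one :
    AntitoneOn (fun t ↦ t ^ 6 * axisRe (extZ 1) t) (Set.Ioi 0) := by
  have h1 : AntitoneOn (fun t ↦ t ^ 6 * axisRe (extZ 1) t) (Set.Ici 1) := by
    refine antitoneOn_of_hasDerivAt_nonpos (convex_Ici 1) (f' := fun t ↦
      t ^ 5 * (6 * axisRe (extZ 1) t - 2 * Real.pi * t * axisRe (D (extZ 1)) t))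
      (fun t ht ↦ ?_) fun t ht ↦ ?_
    · convert! (hasDerivAt_pow 6 t).mul (hasDerivAt_axisRe_extZ 1 (one_pos.trans_le ht)) using 1
      simp
      ring
    · exact mul_nonpos_of_nonneg_of_nonpos (pow_nonneg (zero_le_one.trans ht) 5)
        (sub_nonpos.mpr (six_mul_axisRe_extZ_one_le ht))
  have h2 : MonotoneOn (fun t ↦ t * (6 * axisRe E₆ t + 1008 * Real.pi * t * axisRe (extZ 1) t))
      (Set.Ici 1) := by
    -- The first summand is at least 6 and the subtracted one at most 504·0.0118 < 6.
    refine monotoneOn_of_hasDerivAt_nonneg (convex_Ici 1) (f' := fun t ↦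
      (6 * axisRe E₆ t + 1008 * Real.pi * t * axisRe (extZ 1) t) - 504 * (2 * Real.pi * t *
        (2 * Real.pi * t * axisRe (D (extZ 1)) t - 7 * axisRe (extZ 1) t)))
      (fun t ht ↦ ?_) fun t ht ↦ ?_
    · have ht0 : 0 < t := one_pos.trans_le ht
      convert! (hasDerivAt_id t).mul (((hasDerivAt_axisRe_E6 ht0).const_mul 6).add
        (((hasDerivAt_id t).const_mul (1008 * Real.pi)).mul (hasDerivAt_axisRe_extZ 1 ht0))) using 1
      simp
      ring
    · have h3 := six_le_six_mul_axisRe_E6_add ht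
      have h4 := octic_sum_le ht
      linarith
  refine antitoneOn_Ioi_of_inv h1 (m := fun t ↦ (1008 * Real.pi)⁻¹ *
    (t * (6 * axisRe E₆ t + 1008 * Real.pi * t * axisRe (extZ 1) t))) ?_ fun s hs ↦ ?_
  · intro a ha b hb hab
    have := Real.pi_pos
    exact mul_le_mul_of_nonneg_left (h2 ha hb hab) (by positivity)
  · have hs0 : 0 < s := one_pos.trans_le hs
    rw [← axisRe_extZ_one_inv hs0]
    have := Real.pi_pos
    field_simp

/-! ### Monotonicity in all weights -/

/-- If `t ^ (a + 1) * g t` is antitone, `f' = -g` and `f` vanishes at infinity, then `t ^ a * f t` is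
antitone. -/
lemma antitoneOn_pow_mul_of_deriv {f g : ℝ → ℝ} {a : ℕ} (ha : a ≠ 0)
    (hf : ∀ t, 0 < t → HasDerivAt f (-g t) t) (hlim : Tendsto f atTop (𝓝 0))
    (hg : AntitoneOn (fun t ↦ t ^ (a + 1) * g t) (Set.Ioi 0)) :
    AntitoneOn (fun t ↦ t ^ a * f t) (Set.Ioi 0) := by
  have key : ∀ t, 0 < t → a * f t ≤ t * g t := fun t ht ↦ by
    -- For s ≥ t the hypothesis gives g(s) ≤ c·s^(−a−1). Integrating over [t, ∞) yields a·f(t) ≤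
    -- c·t^(−a) = t·g(t); the monotone function below expresses this without integrals.
    set c : ℝ := t ^ (a + 1) * g t with hc
    have hmono : MonotoneOn (fun s ↦ a * f s - c * (1 / s) ^ a) (Set.Ici t) := by
      refine monotoneOn_of_hasDerivAt_nonneg (convex_Ici t) (f' := fun s ↦
        a * (1 / s) ^ (a + 1) * (c - s ^ (a + 1) * g s)) (fun s hs ↦ ?_) fun s hs ↦ ?_
      · have hs0 : 0 < s := ht.trans_le hs
        convert! ((hf s hs0).const_mul (a : ℝ)).sub
          (((hasDerivAt_one_div hs0).pow a).const_mul c) using 1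
        obtain ⟨b, rfl⟩ := Nat.exists_eq_succ_of_ne_zero ha
        simp only [Nat.succ_eq_add_one, Nat.add_one_sub_one, one_div, inv_pow]
        field_simp
        ring
      · have hs0 : 0 < s := ht.trans_le hs
        exact mul_nonneg (by positivity) (sub_nonneg.mpr (hg ht hs0 hs))
    have hl : Tendsto (fun s ↦ a * f s - c * (1 / s) ^ a) atTop (𝓝 0) := by
      have h1 : Tendsto (fun s : ℝ ↦ (1 / s) ^ a) atTop (𝓝 0) := by
        simpa [ha] using (tendsto_inv_atTop_zero (𝕜 := ℝ)).pow a
      simpa using (hlim.const_mul (a : ℝ)).sub (h1.const_mul c)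
    have hle : a * f t - c * (1 / t) ^ a ≤ 0 := by
      refine ge_of_tendsto hl ?_
      filter_upwards [eventually_ge_atTop t] with s hs
      exact hmono Set.self_mem_Ici hs hs
    have hct : c * (1 / t) ^ a = t * g t := by
      rw [hc, one_div, inv_pow]
      field_simp
      ring
    linarith
  refine antitoneOn_of_hasDerivAt_nonpos (convex_Ioi 0) (f' := fun t ↦
    t ^ (a - 1) * (a * f t - t * g t)) (fun t ht ↦ ?_) fun t ht ↦ ?_
  · convert! (hasDerivAt_pow a t).mul (hf t ht) using 1
    obtain ⟨b, rfl⟩ := Nat.exists_eq_succ_of_ne_zero ha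
    simp only [Nat.succ_eq_add_one, Nat.add_one_sub_one]
    ring
  · exact mul_nonpos_of_nonneg_of_nonpos (pow_nonneg (le_of_lt ht) _) (sub_nonpos.mpr (key t ht))

lemma nonneg_of_deriv_nonpos {f g : ℝ → ℝ} (hf : ∀ t, 0 < t → HasDerivAt f (-g t) t)
    (hlim : Tendsto f atTop (𝓝 0)) (hg : ∀ t, 0 < t → 0 ≤ g t) (ht : 0 < t) : 0 ≤ f t := by
  have h : AntitoneOn f (Set.Ioi 0) := antitoneOn_of_hasDerivAt_nonpos (convex_Ioi 0) hf
    fun s hs ↦ neg_nonpos.mpr (hg s hs)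
  refine le_of_tendsto hlim ?_
  filter_upwards [eventually_ge_atTop t] with s hs
  exact h ht (ht.trans_le hs) hs

/-- `f ≥ 0` on `(0, ∞)` and `t ^ a * f t` is antitone there. -/
def DecaysLike (a : ℕ) (f : ℝ → ℝ) : Prop :=
  (∀ t, 0 < t → 0 ≤ f t) ∧ AntitoneOn (fun t ↦ t ^ a * f t) (Set.Ioi 0)

namespace DecaysLike

variable {a b : ℕ} {f g : ℝ → ℝ}

lemma mul (hf : DecaysLike a f) (hg : DecaysLike b g) : DecaysLike (a + b) (fun t ↦ f t * g t) := by
  refine ⟨fun t ht ↦ mul_nonneg (hf.1 t ht) (hg.1 t ht), fun s hs t ht hst ↦ ?_⟩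
  have hs' : 0 < s := hs
  have ht' : 0 < t := ht
  have h := mul_le_mul (hf.2 hs ht hst) (hg.2 hs ht hst)
    (mul_nonneg (by positivity) (hg.1 t ht)) (mul_nonneg (by positivity) (hf.1 s hs))
  simp only [pow_add] at h ⊢
  linarith

lemma add (hf : DecaysLike a f) (hg : DecaysLike a g) : DecaysLike a (fun t ↦ f t + g t) :=
  ⟨fun t ht ↦ add_nonneg (hf.1 t ht) (hg.1 t ht), fun s hs t ht hst ↦ by
    have h := add_le_add (hf.2 hs ht hst) (hg.2 hs ht hst)
    simp only at h ⊢
    linarith⟩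

lemma const_mul {c : ℝ} (hc : 0 ≤ c) (hf : DecaysLike a f) : DecaysLike a (fun t ↦ c * f t) :=
  ⟨fun t ht ↦ mul_nonneg hc (hf.1 t ht), fun s hs t ht hst ↦ by
    have h := mul_le_mul_of_nonneg_left (hf.2 hs ht hst) hc
    simp only at h ⊢
    linarith⟩

lemma mono (hf : DecaysLike b f) (hab : a ≤ b) : DecaysLike a f := by
  refine ⟨hf.1, fun s hs t ht hst ↦ ?_⟩
  obtain ⟨d, rfl⟩ := Nat.exists_eq_add_of_le hab
  have hs' : 0 < s := hs
  have ht' : 0 < t := ht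
  have h1 := hf.2 hs ht hst
  simp only [pow_add] at h1 ⊢
  have h2 : s ^ d * (t ^ a * f t) ≤ t ^ d * (t ^ a * f t) :=
    mul_le_mul_of_nonneg_right (pow_le_pow_left₀ hs'.le hst d)
      (mul_nonneg (by positivity) (hf.1 t ht))
  have h3 : 0 < s ^ d := by positivity
  refine le_of_mul_le_mul_left ?_ h3
  linarith

lemma of_deriv (ha : a ≠ 0) (hf : ∀ t, 0 < t → HasDerivAt f (-g t) t)
    (hlim : Tendsto f atTop (𝓝 0)) (hg : DecaysLike (a + 1) g) : DecaysLike a f :=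
  ⟨fun _ ht ↦ nonneg_of_deriv_nonpos hf hlim hg.1 ht, antitoneOn_pow_mul_of_deriv ha hf hlim hg.2⟩

lemma congr (hf : DecaysLike a f) (h : ∀ t, 0 < t → g t = f t) : DecaysLike a g :=
  ⟨fun t ht ↦ (h t ht).symm ▸ hf.1 t ht,
    hf.2.congr fun t ht ↦ by rw [h t ht]⟩

end DecaysLike

/-! ### The induction on the weight -/

lemma decaysLike_axisRe_of_deriv {F : ℍ → ℂ} {a : ℕ} (ha : a ≠ 0) (hF : QExpandable F)
    (h0 : (qExpansion 1 F).coeff 0 = 0) (h : DecaysLike (a + 1) (axisRe (D F))) :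
    DecaysLike a (axisRe F) := by
  refine DecaysLike.of_deriv ha (fun t ht ↦ hasDerivAt_axisRe hF.mdiff ht) ?_
    (h.const_mul (c := 2 * Real.pi) Real.two_pi_pos.le)
  simpa [h0] using hF.tendsto_axisRe

lemma DecaysLike.axisRe_mul {F G : ℍ → ℂ} {a b : ℕ} (hr : RealOnAxis F)
    (hF : DecaysLike a (axisRe F)) (hG : DecaysLike b (axisRe G)) :
    DecaysLike (a + b) (axisRe (F * G)) :=
  (hF.mul hG).congr fun _ ht ↦ ExtremalQuasimodular.axisRe_mul hr ht

lemma DecaysLike.axisRe_add {F G : ℍ → ℂ} {a : ℕ}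
    (hF : DecaysLike a (axisRe F)) (hG : DecaysLike a (axisRe G)) :
    DecaysLike a (axisRe (F + G)) :=
  (hF.add hG).congr fun t _ ↦ ExtremalQuasimodular.axisRe_add F G t

lemma DecaysLike.axisRe_smul {F : ℍ → ℂ} {a : ℕ} {c : ℝ} (hc : 0 ≤ c)
    (hF : DecaysLike a (axisRe F)) : DecaysLike a (axisRe ((c : ℂ) • F)) :=
  (hF.const_mul hc).congr fun t _ ↦ ExtremalQuasimodular.axisRe_smul c F t

lemma decaysLike_extY_one : DecaysLike 5 (axisRe (extY 1)) :=
  ⟨fun _ ht ↦ (Real.exp_pos _).le.trans (exp_le_axisRe_extY_one ht), antitoneOn_axisRe_extY_one⟩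

lemma decaysLike_extZ_one : DecaysLike 6 (axisRe (extZ 1)) :=
  ⟨fun _ ht ↦ axisRe_extZ_one_nonneg ht, antitoneOn_axisRe_extZ_one⟩

lemma decaysLike_E4_mul_extY_one : DecaysLike 8 (axisRe (E₄ * extY 1)) :=
  ⟨fun t ht ↦ by
    rw [axisRe_mul realOnAxis_E4 ht]
    exact mul_nonneg (zero_le_one.trans (one_le_axisRe_E4 ht)) (decaysLike_extY_one.1 t ht),
    antitoneOn_axisRe_E4_mul_extY_one⟩

lemma decaysLike_deriv_combination {F₁ G₁ F₂ G₂ : ℍ → ℂ} {a b₁ c₁ b₂ c₂ : ℕ} (k : ℕ)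
    (hr₁ : RealOnAxis F₁) (hF₁ : DecaysLike b₁ (axisRe F₁)) (hG₁ : DecaysLike c₁ (axisRe G₁))
    (hr₂ : RealOnAxis F₂) (hF₂ : DecaysLike b₂ (axisRe F₂)) (hG₂ : DecaysLike c₂ (axisRe G₂))
    (h₁ : a ≤ b₁ + c₁) (h₂ : a ≤ b₂ + c₂) :
    DecaysLike a (axisRe ((6 * k + 6 : ℂ) •
      ((5 / 72 : ℂ) • (F₁ * G₁) + (7 / 72 : ℂ) • (F₂ * G₂)))) := by
  have h := (((hF₁.axisRe_mul hr₁ hG₁).mono h₁).axisRe_smul (c := 5 / 72) (by norm_num)).axisRe_add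
    (((hF₂.axisRe_mul hr₂ hG₂).mono h₂).axisRe_smul (c := 7 / 72) (by norm_num))
  have h' := h.axisRe_smul (c := 6 * k + 6) (by positivity)
  push_cast at h'
  exact h'

/-- The induction starts at index 1, because Y₀ = 1 and Z₀ = E2 do not vanish at infinity. Each
product in a derivative must have one more power of decay than the form itself: for Y_{k+2} the
exponents 5 + (5(k+1)+1) and 6 + 5(k+1) are exactly 5(k+2) + 1. -/
lemma decaysLike_ext (k : ℕ) : DecaysLike (5 * (k + 1)) (axisRe (extY (k + 1))) ∧
    DecaysLike (5 * (k + 1) + 1) (axisRe (extZ (k + 1))) ∧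
    DecaysLike (5 * (k + 1) + 3) (axisRe (E₄ * extY (k + 1))) := by
  induction k with
  | zero => exact ⟨decaysLike_extY_one, decaysLike_extZ_one, decaysLike_E4_mul_extY_one⟩
  | succ k ih =>
    obtain ⟨ihY, ihZ, ihU⟩ := ih
    have rY := (realOnAxis_ext 1).1
    have rZ := (realOnAxis_ext 1).2
    have hY : DecaysLike (5 * (k + 1 + 1)) (axisRe (extY (k + 1 + 1))) := by
      refine decaysLike_axisRe_of_deriv (by omega) (qExpandable_extY _) (coeff_zero_extY_succ _) ?_
      rw [normalizedDeriv_extY_succ]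
      exact decaysLike_deriv_combination _ rY decaysLike_extY_one ihZ rZ decaysLike_extZ_one ihY
        (by omega) (by omega)
    refine ⟨hY, ?_, ?_⟩
    · refine decaysLike_axisRe_of_deriv (by omega) (qExpandable_extZ _) (coeff_zero_extZ_succ _) ?_
      rw [normalizedDeriv_extZ_succ]
      exact decaysLike_deriv_combination _ rY decaysLike_extY_one ihU rZ decaysLike_extZ_one ihZ
        (by omega) (by omega)
    · refine decaysLike_axisRe_of_deriv (by omega) (qExpandable_E4.mul (qExpandable_extY _)) ?_ ?_
      · rw [qExpandable_E4.qExpansion_mul (qExpandable_extY _), coeff_zero_mul,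
          coeff_zero_extY_succ, mul_zero]
      · rw [normalizedDeriv_E4_mul_extY]
        refine DecaysLike.axisRe_add ?_ (decaysLike_deriv_combination _ (realOnAxis_E4.mul rY)
          decaysLike_E4_mul_extY_one ihZ rZ decaysLike_extZ_one ihU (by omega) (by omega))
        -- The term Y₁Y_{k+2} contains the form of the same level, so the new bound `hY` is needed;
        -- it leaves one power to spare.
        have h := ((decaysLike_extY_one.axisRe_mul rY hY).mono
          (show 5 * (k + 1 + 1) + 3 + 1 ≤ _ by omega)).axisRe_smul (c := 240) (by norm_num)
        push_cast at h
        exact h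

lemma exists_of_decaysLike {w : ℤ} {a : ℕ} {X : ℍ → ℂ} (hX : IsNormalizedExtremal w 1 X ∧
    ∀ Y : ℍ → ℂ, IsNormalizedExtremal w 1 Y → Y = X) (hr : RealOnAxis X)
    (ha : w - ⌈(w : ℚ) / 6⌉ = a) (hd : DecaysLike a (axisRe X)) :
    ∃ X : ℍ → ℂ, IsNormalizedExtremal w 1 X ∧
      (∀ Y : ℍ → ℂ, IsNormalizedExtremal w 1 Y → Y = X) ∧
      (∀ t : ℝ, 0 < t → (onImagAxis X t).im = 0) ∧
      AntitoneOn (fun t : ℝ ↦ t ^ (w - ⌈(w : ℚ) / 6⌉) * (onImagAxis X t).re) (Set.Ioi 0) := by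
  refine ⟨X, hX.1, hX.2, hr, ?_⟩
  rw [ha]
  simpa only [zpow_natCast, axisRe] using hd.2

end ExtremalQuasimodular

/-! ### The three residue classes of even weights modulo 6 -/

theorem mainTheorem3 (w : ℤ) (hw : Even w) (hw6 : 6 ≤ w) :
    ∃ X : ℍ → ℂ, IsNormalizedExtremal w 1 X ∧
      (∀ Y : ℍ → ℂ, IsNormalizedExtremal w 1 Y → Y = X) ∧
      (∀ t : ℝ, 0 < t → (onImagAxis X t).im = 0) ∧
      AntitoneOn (fun t : ℝ ↦ t ^ (w - ⌈(w : ℚ) / 6⌉) * (onImagAxis X t).re) (Set.Ioi 0) := by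
  open ExtremalQuasimodular in
  obtain ⟨k, rfl | rfl | rfl⟩ : ∃ k : ℕ, w = 6 * (k + 1 : ℕ) ∨ w = 6 * (k + 1 : ℕ) + 2 ∨
      w = 6 * (k + 1 : ℕ) + 4 := by
    obtain ⟨v, rfl⟩ := hw
    exact ⟨((v + v) / 6 - 1).toNat, by omega⟩
  · refine exists_of_decaysLike (isNormalizedExtremal_extY (k + 1)) (realOnAxis_ext (k + 1)).1 ?_
      (decaysLike_ext k).1
    have : ⌈((6 * (k + 1 : ℕ) : ℤ) : ℚ) / 6⌉ = k + 1 := by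
      rw [Int.ceil_eq_iff]
      constructor <;> push_cast <;> linarith
    rw [this]
    push_cast
    ring
  · refine exists_of_decaysLike (isNormalizedExtremal_extZ (k + 1)) (realOnAxis_ext (k + 1)).2 ?_
      (decaysLike_ext k).2.1
    have : ⌈((6 * (k + 1 : ℕ) + 2 : ℤ) : ℚ) / 6⌉ = k + 2 := by
      rw [Int.ceil_eq_iff]
      constructor <;> push_cast <;> linarith
    rw [this]
    push_cast
    ring
  · refine exists_of_decaysLike (isNormalizedExtremal_E4_mul_extY (k + 1))
      (realOnAxis_E4.mul (realOnAxis_ext (k + 1)).1) ?_ (decaysLike_ext k).2.2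
    have : ⌈((6 * (k + 1 : ℕ) + 4 : ℤ) : ℚ) / 6⌉ = k + 2 := by
      rw [Int.ceil_eq_iff]
      constructor <;> push_cast <;> linarith
    rw [this]
    push_cast
    ring
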